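/- **Setting.** Measurements have outcomes $a=\pm1$ and settings $x\in\{0,1\}$. A measurement system $A$ assigns to each party $k$, acting on a Hilbert space $H_k$, POVMs $\{A^{(k)}_{a|x}\}_a$; its dichotomic operators are $K^{(k)}_x=A^{(k)}_{+1|x}-A^{(k)}_{-1|x}$. A Bell functional $\mathsf B$ is a real linear combination of tensor products of the $K^{(k)}_x$ and identities; $\mathsf B[K]$ is the resulting operator, and $|\mathsf B|\le c$ means $-c\,\mathbb I\le \mathsf B[K]\le c\,\mathbb I$ for all measurement systems on all Hilbert spaces. A (normalized) $q\to1$ connector is a real tensor $\mathsf C^{a_1\dots a_q|x_1\dots x_q}_{b|y}$ whose contraction with $q$ legs of any multipartite quantum behaviour is again a quantum behaviour, and such that $\mathsf C_{b|y}[A]=\sum_{\vec a,\vec x}\mathsf C^{\vec a|\vec x}_{b|y}\bigotimes_k A^{(k)}_{a_k|x_k}$ satisfies $\sum_b \mathsf C_{b|y}[A]=\mathbb I$ for all measurement systems $A$ and all $y$. A connector complex is a triple $(\mathsf C,\bar A,V)$ of such a connector, a measurement system $\bar A$ and a coisometry $V$ ($VV^\dagger=\mathbb I$) for which the operators $\bar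 M_{b|y}=V\mathsf C_{b|y}[\bar A]V^\dagger$ form a projective measurement; then $\mathsf C$ is called tight. Let $\sigma_1=X,\sigma_2=Y,\sigma_3=Z$ be the Pauli matrices. Given Bell functionals $\mathsf B_0,\mathsf B_1$, dichotomic qubit operators $\bar K$, and vectors $\phi,\phi'$, we say that $(\mathsf B_0,\mathsf B_1,\bar K,\phi,\phi')$ *gives a tight connector complex with output operators $S_0,S_1$* if $|\mathsf B_0|\le1$ and $|\mathsf B_1|\le 1$, and there is a connector with $\mathsf C_{\pm|y}[A]=\frac{\mathbb I\pm\mathsf B_y[K]}2$ for all $A$ which, together with $\bar A^{(k)}_{\pm|x}=\frac{\mathbb I\pm\bar K^{(k)}_x}{2}$ and $V=|0\rangle\langle\phi|+|1\rangle\langle\phi'|$, is a connector complex with $\bar M_{\pm|y}=\frac{\mathbb I\pm S_y}{2}$. **Theorem.** 1. *CHSH–Tsirelson.* Let $2\sqrt2\,\mathsf B_0[K]=-K^{(1)}_0\otimes K^{(2)}_0+K^{(1)}_1\otimes K^{(2)}_0+K^{(1)}_0\otimes K^{(2)}_1+K^{(1)}_1\otimes K^{(2)}_1$, $2\sqrt2\,\mathsf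 B_1[K]=K^{(1)}_0\otimes K^{(2)}_0+K^{(1)}_1\otimes K^{(2)}_0+K^{(1)}_0\otimes K^{(2)}_1-K^{(1)}_1\otimes K^{(2)}_1$, $\bar K^{(1)}_0=\sigma_3$, $\bar K^{(1)}_1=\sigma_1$, $\bar K^{(2)}_0=\frac{\sigma_3+\sigma_1}{\sqrt2}$, $\bar K^{(2)}_1=\frac{\sigma_3-\sigma_1}{\sqrt2}$, $|\phi_+\rangle=\frac{|00\rangle+|11\rangle}{\sqrt2}$, $|\phi_-\rangle=\frac{|10\rangle-|01\rangle}{\sqrt2}$. Then $\mathsf B_1[\bar K]|\phi_\pm\rangle=\pm|\phi_\pm\rangle$ and $\mathsf B_0[\bar K]|\phi_\pm\rangle=|\phi_\mp\rangle$, and $(\mathsf B_0,\mathsf B_1,\bar K,\phi_+,\phi_-)$ gives a tight connector complex with output operators $\sigma_1,\sigma_3$. 2. *Tilted CHSH.* Let $\theta\in\mathbb R$, $\alpha=2\,\mathrm{sgn}(\cos2\theta)\,(1+2\tan^2 2\theta)^{-1/2}$ (with $\alpha=0$ if $\cos 2\theta=0$), $\beta=\sqrt{8+2\alpha^2}$,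 $\mu=\arctan(\sin2\theta)$. Let $\beta\,\mathsf B_0$ and $\beta\,\mathsf B_1$ be the right-hand sides of the two formulas in 1 plus $\alpha K^{(1)}_1\otimes\mathbb I$ and $\alpha K^{(1)}_0\otimes\mathbb I$, respectively; let $\bar K^{(1)}_0=\sigma_3$, $\bar K^{(1)}_1=\sigma_1$, $\bar K^{(2)}_0=\cos\mu\,\sigma_3+\sin\mu\,\sigma_1$, $\bar K^{(2)}_1=\cos\mu\,\sigma_3-\sin\mu\,\sigma_1$, $|\phi_+\rangle=\cos\theta|00\rangle+\sin\theta|11\rangle$, $|\phi_-\rangle=\cos\theta|10\rangle-\sin\theta|01\rangle$. Then $\mathsf B_1[\bar K]|\phi_\pm\rangle=\pm|\phi_\pm\rangle$ and $\mathsf B_0[\bar K]|\phi_\pm\rangle=|\phi_\mp\rangle$, and $(\mathsf B_0,\mathsf B_1,\bar K,\phi_+,\phi_-)$ gives a tight connector complex with output operators $\sigma_1,\sigma_3$. 3. *WBC.* Let $\theta,\varphi,\omega\in\mathbb R$ with $\cos(\theta+\varphi)\cos(\varphi)\cos(\theta+\omega)\cos(\omega)<0$, let $\beta=\sin\theta\,\sin(\omega-\varphi)\,\sin(\theta+\varphi+\omega)$,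 $\beta\,\mathsf B_1[K]=\cos(\theta+\varphi)\cos(\theta+\omega)\big(\cos\omega\,K^{(1)}_0\otimes K^{(2)}_0-\cos\varphi\,K^{(1)}_0\otimes K^{(2)}_1\big)+\cos\varphi\cos\omega\big(\cos(\theta+\varphi)\,K^{(1)}_1\otimes K^{(2)}_1-\cos(\theta+\omega)\,K^{(1)}_1\otimes K^{(2)}_0\big)$, and let $\mathsf B_0$ be $\mathsf B_1$ with settings $0$ and $1$ exchanged for both parties. Let $\bar K^{(1)}_0=\sigma_1$, $\bar K^{(1)}_1=\cos\theta\,\sigma_1+\sin\theta\,\sigma_2$, $\bar K^{(2)}_0=\cos\varphi\,\sigma_1+\sin\varphi\,\sigma_2$, $\bar K^{(2)}_1=\cos\omega\,\sigma_1+\sin\omega\,\sigma_2$, $|\phi_\pm\rangle=\frac{|00\rangle\pm i|11\rangle}{\sqrt2}$, and $\delta=\theta+\varphi+\omega$. Then $\mathsf B_1[\bar K]|\phi_\pm\rangle=\pm|\phi_\pm\rangle$, $\mathsf B_0[\bar K]|\phi_+\rangle=-\cos\delta|\phi_+\rangle+i\sin\delta|\phi_-\rangle$, $\mathsf B_0[\bar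 K]|\phi_-\rangle=\cos\delta|\phi_-\rangle-i\sin\delta|\phi_+\rangle$, and $(\mathsf B_0,\mathsf B_1,\bar K,\phi_+,-\phi_-)$ gives a tight connector complex with output operators $-\cos\delta\,\sigma_3-\sin\delta\,\sigma_2$ and $\sigma_3$. 4. *BASTA.* Let $\mathcal G$ be a finite simple graph on $q$ vertices, $v_1$ a vertex with $n_1$ neighbours, and $n(i)$ the set of neighbours of $i$. Let $\mathsf B[K]=n_1(K^{(1)}_0+K^{(1)}_1)\bigotimes_{i\in n(1)}K^{(i)}_1+\sum_{i\in n(1)}(K^{(1)}_0-K^{(1)}_1)\otimes K^{(i)}_0\bigotimes_{1\ne j\in n(i)}K^{(j)}_1+\sum_{j\notin n(1)\cup\{1\}}K^{(j)}_0\bigotimes_{k\in n(j)}K^{(k)}_1$, $\mathsf B'[K]=n_1(K^{(1)}_0-K^{(1)}_1)\bigotimes_{i>1}K^{(i)}_1-\sum_{i\in n(1)}(K^{(1)}_0+K^{(1)}_1)\otimes K^{(i)}_0\bigotimes_{j\in\mathsf{EN}_i}K^{(j)}_1$, where $\mathsf{EN}_i$ is the set of vertices adjacent to both $v_1$ and $v_i$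 or to neither. Let $\bar K^{(1)}_0=\frac{X+Z}{\sqrt2}$, $\bar K^{(1)}_1=\frac{X-Z}{\sqrt2}$, and $\bar K^{(j)}_0=X$, $\bar K^{(j)}_1=Z$ for $j\neq1$. Let $|\phi_+\rangle=2^{-q/2}\sum_{\vec x}(-1)^{\sum_{ij\in\mathcal E}x_ix_j}|\vec x\rangle$ and $|\phi_-\rangle=\bigotimes_iZ_i|\phi_+\rangle$ be the graph and antigraph states; put $\beta_1=(2\sqrt2-1)n_1+q-1$ and $\beta_0=2\sqrt2\,n_1$. Then $X_j\bigotimes_{k\in n(j)}Z_k|\phi_\pm\rangle=\pm|\phi_\pm\rangle$ for every vertex $j$; $|\mathsf B|\le\beta_1$ and $\mathsf B[\bar K]|\phi_\pm\rangle=\pm\beta_1|\phi_\pm\rangle$; $|\mathsf B'|\le2\sqrt2\,n_1$ and $\mathsf B'[\bar K]|\phi_\pm\rangle=2\sqrt2\,n_1|\phi_\mp\rangle$. If $n_1\ge1$, then $\mathsf B_1=\mathsf B/\beta_1$ and $\mathsf B_0=\mathsf B'/\beta_0$ satisfy $\mathsf B_1[\bar K]|\phi_\pm\rangle=\pm|\phi_\pm\rangle$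 and $\mathsf B_0[\bar K]|\phi_\pm\rangle=|\phi_\mp\rangle$, and $(\mathsf B_0,\mathsf B_1,\bar K,\phi_+,\phi_-)$ gives a tight connector complex with output operators $\sigma_1,\sigma_3$. -/

import Mathlib

open scoped ENNReal

universe u

noncomputable section

/-! ### Hilbert spaces, kets and tensor products of operators

Every Hilbert space is `ℓ²(ι)` for some index set `ι`, up to unitary equivalence, and the Hilbert
space tensor product of the spaces `ℓ²(ι v)` is `ℓ²(∏ v, ι v)`. -/

/-- The complex Hilbert space `ℓ²(ι)`. For `ι = Fin 2` it is a qubit. -/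
abbrev Hil (ι : Type*) : Type _ := lp (fun _ : ι => ℂ) 2

/-- Bounded operators on `ℓ²(ι)`. -/
abbrev Op (ι : Type*) := Hil ι →L[ℂ] Hil ι

open Classical in
/-- The standard basis vector `|i⟩`. -/
def ket {ι : Type*} (i : ι) : Hil ι := lp.single 2 i (1 : ℂ)

theorem ket_apply {ι : Type*} [DecidableEq ι] (i j : ι) :
    (ket i) j = if j = i then (1 : ℂ) else 0 := by
  by_cases h : j = i
  · subst h
    rw [if_pos rfl]
    exact @lp.single_apply_self ι (fun _ => ℂ) _ (_) 2 j 1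
  · rw [if_neg h]
    exact @lp.single_apply_ne ι (fun _ => ℂ) _ (_) 2 i 1 _ h

theorem enorm_sq_eq_ofReal {E : Type*} [NormedAddCommGroup E] (x : E) :
    ‖x‖ₑ ^ 2 = ENNReal.ofReal (‖x‖ ^ 2) := by
  rw [← ofReal_norm, ENNReal.ofReal_pow (norm_nonneg _)]

theorem enorm_sq_hil {ι : Type*} (f : Hil ι) : ∑' i, ‖f i‖ₑ ^ 2 = ‖f‖ₑ ^ 2 := by
  have h := lp.hasSum_norm (p := 2) (by norm_num) f
  have h' : HasSum (fun i => ‖f i‖ ^ 2) (‖f‖ ^ 2) := by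
    simpa using h
  refine (tsum_congr fun i => enorm_sq_eq_ofReal (f i)).trans ?_
  refine Eq.trans ?_ (enorm_sq_eq_ofReal f).symm
  rw [← h'.tsum_eq, ENNReal.ofReal_tsum_of_nonneg (fun _ => by positivity) h'.summable]

theorem memHil_of_enorm {ι : Type*} {f : ι → ℂ} (h : ∑' i, ‖f i‖ₑ ^ 2 ≠ ⊤) :
    Memℓp f 2 := by
  apply memℓp_gen
  have h2 := ENNReal.summable_toReal h
  refine h2.congr fun i => ?_
  simp [ENNReal.toReal_pow]

section Leg

variable {V : Type*} [DecidableEq V] {ι : V → Type*}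

/-- The restriction of `f ∈ ℓ²(∏ v, ι v)` to the line through `i` in direction `k`. -/
def lineRestrict (k : V) (i : ∀ v, ι v) (f : Hil (∀ v, ι v)) : Hil (ι k) :=
  ⟨fun t => f (Function.update i k t), by
    apply memℓp_gen
    exact ((lp.memℓp f).summable (by norm_num)).comp_injective (Function.update_injective i k)⟩

theorem lineRestrict_apply (k : V) (i : ∀ v, ι v) (f : Hil (∀ v, ι v)) (t : ι k) :
    lineRestrict k i f t = f (Function.update i k t) := rfl

theorem leg_bound (k : V) (A : Op (ι k)) (f : Hil (∀ v, ι v)) :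
    ∑' i : ∀ v, ι v, ‖(A (lineRestrict k i f)) (i k)‖ₑ ^ 2 ≤ ‖A‖ₑ ^ 2 * ‖f‖ₑ ^ 2 := by
  classical
  let e := (Equiv.piSplitAt k ι).symm
  have hk : ∀ t r, e (t, r) k = t := fun t r => by simp [e]
  have hu : ∀ t r s, Function.update (e (t, r)) k s = e (s, r) := by
    intro t r s
    funext v
    by_cases hv : v = k
    · subst hv; simp [e]
    · simp [e, hv]
  have split : ∀ g : (∀ v, ι v) → ℝ≥0∞, ∑' i, g i = ∑' r, ∑' t, g (e (t, r)) := by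
    intro g
    rw [← e.tsum_eq, ENNReal.tsum_prod', ENNReal.tsum_comm]
  rw [split, ← enorm_sq_hil f, split, ← ENNReal.tsum_mul_left]
  refine ENNReal.tsum_le_tsum fun r => ?_
  rcases isEmpty_or_nonempty (ι k) with hE | ⟨⟨t₀⟩⟩
  · simp
  have hl : ∀ t, lineRestrict k (e (t, r)) f = lineRestrict k (e (t₀, r)) f := by
    intro t
    ext s
    simp only [lineRestrict_apply, hu]
  have h1 : ∑' t, ‖(A (lineRestrict k (e (t, r)) f)) (e (t, r) k)‖ₑ ^ 2
      = ‖A (lineRestrict k (e (t₀, r)) f)‖ₑ ^ 2 := by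
    rw [← enorm_sq_hil]
    refine tsum_congr fun t => ?_
    rw [hl, hk]
  have h2 : ∑' t, ‖f (e (t, r))‖ₑ ^ 2 = ‖lineRestrict k (e (t₀, r)) f‖ₑ ^ 2 := by
    rw [← enorm_sq_hil]
    refine tsum_congr fun t => ?_
    rw [lineRestrict_apply, hu]
  rw [h1, h2, ← mul_pow]
  gcongr
  exact ContinuousLinearMap.le_opENorm A _

/-- The operator `A` acting on the tensor factor `k` of `ℓ²(∏ v, ι v)`. -/
def leg (k : V) (A : Op (ι k)) : Op (∀ v, ι v) :=
  LinearMap.mkContinuous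
    { toFun := fun f => (⟨fun i => (A (lineRestrict k i f)) (i k),
        memHil_of_enorm (ne_top_of_le_ne_top (by finiteness) (leg_bound k A f))⟩ :
          Hil (∀ v, ι v))
      map_add' := by
        intro f g
        ext i
        have : lineRestrict k i (f + g) = lineRestrict k i f + lineRestrict k i g := by
          ext t; rfl
        change (A (lineRestrict k i (f + g))) (i k) = _
        rw [this, map_add]
        rfl
      map_smul' := by
        intro c f
        ext i
        have : lineRestrict k i (c • f) = c • lineRestrict k i f := by
          ext t; rfl
        change (A (lineRestrict k i (c • f))) (i k) = _
        rw [this, map_smul]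
        rfl }
    ‖A‖ (by
      intro f
      have h := leg_bound k A f
      rw [← mul_pow] at h
      set g : Hil (∀ v, ι v) := ⟨fun i => (A (lineRestrict k i f)) (i k),
        memHil_of_enorm (ne_top_of_le_ne_top (by finiteness) (leg_bound k A f))⟩
      have h' : ‖g‖ₑ ^ 2 ≤ (‖A‖ₑ * ‖f‖ₑ) ^ 2 := by
        rw [← enorm_sq_hil]; exact h
      have h'' : ‖g‖ₑ ≤ ‖A‖ₑ * ‖f‖ₑ := (ENNReal.pow_le_pow_left_iff (by norm_num)).1 h'
      have := ENNReal.toReal_mono (by finiteness) h''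
      simpa [ENNReal.toReal_mul] using this)

theorem leg_apply (k : V) (A : Op (ι k)) (f : Hil (∀ v, ι v)) (i : ∀ v, ι v) :
    (leg k A f) i = (A (lineRestrict k i f)) (i k) := rfl

end Leg

theorem exists_tensorOp {V : Type*} [Fintype V] {ι : V → Type*} (A : ∀ v, Op (ι v)) :
    ∃ T : Op (∀ v, ι v), ∀ i j : ∀ v, ι v,
      (T (ket j)) i = ∏ v, (A v (ket (j v))) (i v) := by
  classical
  suffices h : ∀ s : Finset V, ∃ T : Op (∀ v, ι v), ∀ i j : ∀ v, ι v,
      (T (ket j)) i = ∏ v, if v ∈ s then (A v (ket (j v))) (i v) else ket (j v) (i v) by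
    obtain ⟨T, hT⟩ := h Finset.univ
    exact ⟨T, fun i j => by simpa using hT i j⟩
  intro s
  induction s using Finset.induction_on with
  | empty =>
    refine ⟨1, fun i j => ?_⟩
    simp only [Finset.notMem_empty, if_false, ket_apply, one_apply_eq_self]
    by_cases hij : i = j
    · simp [hij]
    · obtain ⟨v, hv⟩ := Function.ne_iff.1 hij
      rw [if_neg hij, Finset.prod_eq_zero (Finset.mem_univ v) (by simp [hv])]
  | insert k s hk ih =>
    obtain ⟨T, hT⟩ := ih
    refine ⟨leg k (A k) * T, fun i j => ?_⟩
    set c : ℂ := ∏ v ∈ Finset.univ.erase k,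
      if v ∈ s then (A v (ket (j v))) (i v) else ket (j v) (i v) with hc
    have hl : lineRestrict k i (T (ket j)) = c • ket (j k) := by
      ext t
      rw [lineRestrict_apply, hT, ← Finset.mul_prod_erase _ _ (Finset.mem_univ k)]
      simp only [hk, if_false, Function.update_self]
      rw [mul_comm]
      change _ = c * (ket (j k)) t
      congr 1
      refine Finset.prod_congr rfl fun v hv => ?_
      rw [Function.update_of_ne (Finset.ne_of_mem_erase hv)]
    rw [mul_apply_eq_comp, leg_apply, hl, map_smul,
      ← Finset.mul_prod_erase _ _ (Finset.mem_univ k)]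
    simp only [Finset.mem_insert_self, if_true]
    change c * _ = _
    rw [mul_comm]
    congr 1
    refine Finset.prod_congr rfl fun v hv => ?_
    simp [Finset.ne_of_mem_erase hv]

/-- The tensor product `⨂ v, A v`: the bounded operator on `ℓ²(∏ v, ι v)` whose matrix elements in
the standard basis are `⟨i| ⨂ A |j⟩ = ∏ v, ⟨i v| A v |j v⟩`. -/
def tensorOp {V : Type*} [Fintype V] {ι : V → Type*} (A : ∀ v, Op (ι v)) : Op (∀ v, ι v) :=
  (exists_tensorOp A).choose

theorem tensorOp_ket {V : Type*} [Fintype V] {ι : V → Type*} (A : ∀ v, Op (ι v))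
    (i j : ∀ v, ι v) : (tensorOp A (ket j)) i = ∏ v, (A v (ket (j v))) (i v) :=
  (exists_tensorOp A).choose_spec i j

/-- A bounded operator is determined by its values on the standard basis. -/
theorem op_ext_ket {ι κ : Type*} {S T : Hil ι →L[ℂ] Hil κ} (h : ∀ j, S (ket j) = T (ket j)) :
    S = T := by
  classical
  ext1 f
  have hf : HasSum (fun i => f i • ket i) f := by
    have h1 := lp.hasSum_single (p := 2) (by norm_num) f
    have h2 : (fun i => f i • ket i) = fun i => lp.single 2 i (f i) := by
      funext i
      have := lp.single_smul (E := fun _ : ι => ℂ) 2 i (f i) (1 : ℂ)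
      simp only [smul_eq_mul, mul_one] at this
      rw [this, ket]
    rw [h2]
    exact h1
  rw [← (S.hasSum hf).tsum_eq, ← (T.hasSum hf).tsum_eq]
  simp [h]

/-! ### Measurements, quantum behaviours and connectors -/

/-- `A a x` is the POVM element of outcome `a` in setting `x`. -/
def IsMeasurement {O X : Type*} [Fintype O] {ι : Type*} (A : O → X → Op ι) : Prop :=
  (∀ a x, (A a x).IsPositive) ∧ ∀ x, ∑ a, A a x = 1

/-- Each setting is a complete family of orthogonal projectors. -/
def IsProjectiveMeasurement {O X : Type*} [Fintype O] {ι : Type*} (M : O → X → Op ι) : Prop :=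
  (∀ a x, IsStarProjection (M a x)) ∧ ∀ x, ∑ a, M a x = 1

/-- Operators for two groups of parties, as one family. -/
def joinOps {V W : Type*} {ι : V → Type u} {κ : W → Type u}
    (A : ∀ v, Op (ι v)) (D : ∀ w, Op (κ w)) : ∀ s : V ⊕ W, Op (Sum.elim ι κ s)
  | Sum.inl v => A v
  | Sum.inr w => D w

/-- `P(a, c | x, z)` is a quantum behaviour of the parties `V ⊕ W`, where the parties in `V` have
outcomes `a` and settings `x` and the parties in `W` have outcomes `c` and settings `z`:
`P(a, c | x, z) = Tr ((⨂ A_{a|x} ⊗ ⨂ D_{c|z}) ρ)` for some measurements and some density operator,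
written as `ρ = ∑ n, |ψ n⟩⟨ψ n|` with `∑ n, ‖ψ n‖² = 1`. -/
def IsQuantumBehaviour {V W : Type} [Fintype V] [Fintype W] {O X O' X' : Type}
    [Fintype O] [Fintype O'] (P : (V → O) → (V → X) → (W → O') → (W → X') → ℝ) : Prop :=
  ∃ (ι : V → Type u) (κ : W → Type u)
    (A : ∀ v, O → X → Op (ι v)) (D : ∀ w, O' → X' → Op (κ w))
    (ψ : ℕ → Hil (∀ s : V ⊕ W, Sum.elim ι κ s)),
    (∀ v, IsMeasurement (A v)) ∧ (∀ w, IsMeasurement (D w)) ∧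
    HasSum (fun n => ‖ψ n‖ ^ 2) 1 ∧
    ∀ a x c z, HasSum
      (fun n => inner ℂ (ψ n) (tensorOp
        (joinOps (fun v => A v (a v) (x v)) (fun w => D w (c w) (z w))) (ψ n)))
      (P a x c z : ℂ)

/-- The tensor `C_{b|y}^{a|x}` of a `V → 1` connector: `b`, `y` are the outcome and the setting of
the output leg, `a`, `x` those of the input legs. -/
abbrev ConnectorTensor (V O X B Y : Type) := B → Y → (V → O) → (V → X) → ℝ

/-- `C_{b|y}[A] = ∑_{a,x} C_{b|y}^{a|x} ⨂ v, A v_{a v|x v}`. -/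
def ConnectorTensor.apply {V O X B Y : Type} [Fintype V] [DecidableEq V] [Fintype O] [Fintype X]
    (C : ConnectorTensor V O X B Y) {ι : V → Type*} (A : ∀ v, O → X → Op (ι v)) (b : B) (y : Y) :
    Op (∀ v, ι v) :=
  ∑ a : V → O, ∑ x : V → X, (C b y a x : ℂ) • tensorOp (fun v => A v (a v) (x v))

/-- `C` is a normalized connector: contracting the legs `V` of any quantum behaviour, shared
with any finite set `W` of further parties, gives a quantum behaviour of the output leg and
the parties `W`, and `∑_b C_{b|y}[A] = 1` for all measurement systems `A`. -/
def ConnectorTensor.IsConnector {V O X B Y : Type} [Fintype V] [DecidableEq V] [Fintype O]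
    [Fintype X] [Fintype B] (C : ConnectorTensor V O X B Y) : Prop :=
  (∀ (W O' X' : Type) [Fintype W] [Fintype O']
    (P : (V → O) → (V → X) → (W → O') → (W → X') → ℝ),
    IsQuantumBehaviour.{u} P →
    IsQuantumBehaviour.{u} (fun (b : Unit → B) (y : Unit → Y) c z =>
      ∑ a : V → O, ∑ x : V → X, C (b ()) (y ()) a x * P a x c z)) ∧
  ∀ (ι : V → Type u) (A : ∀ v, O → X → Op (ι v)), (∀ v, IsMeasurement (A v)) →
    ∀ y, ∑ b, C.apply A b y = 1

/-- The renormalized operators `M_{b|y} = T C_{b|y}[A] T†`. -/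
def ConnectorTensor.renormalized {V O X B Y : Type} [Fintype V] [DecidableEq V] [Fintype O]
    [Fintype X] (C : ConnectorTensor V O X B Y) {ι : V → Type*} {κ : Type*}
    (A : ∀ v, O → X → Op (ι v)) (T : Hil (∀ v, ι v) →L[ℂ] Hil κ) (b : B) (y : Y) : Op κ :=
  T ∘L C.apply A b y ∘L T.adjoint

/-- `(C, A, T)` is a connector complex: `C` is a connector, `A` a measurement system, `T` a
coisometry, and the operators `T C_{b|y}[A] T†` form a projective measurement. In particular
`C` is tight. -/
structure IsConnectorComplex {V O X B Y : Type} [Fintype V] [DecidableEq V] [Fintype O]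
    [Fintype X] [Fintype B] (C : ConnectorTensor V O X B Y) {ι : V → Type*} {κ : Type*}
    (A : ∀ v, O → X → Op (ι v)) (T : Hil (∀ v, ι v) →L[ℂ] Hil κ) : Prop where
  isConnector : ConnectorTensor.IsConnector.{u} C
  isMeasurement : ∀ v, IsMeasurement (A v)
  coisometry : T ∘L T.adjoint = 1
  projective : IsProjectiveMeasurement (C.renormalized A T)

/-! ### Bell functionals with outcomes `±1` and settings `0, 1` -/

/-- The dichotomic operators `K_x = A_{+1|x} - A_{-1|x}`. -/
def correlator {ι : Type*} (A : ℤˣ → Fin 2 → Op ι) (x : Fin 2) : Op ι := A 1 x - A (-1) x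

/-- The measurement `A_{b|x} = (1 + b K_x) / 2` with dichotomic operators `K_x`. -/
def dichotomic {ι : Type*} (K : Fin 2 → Op ι) (b : ℤˣ) (x : Fin 2) : Op ι :=
  (1 / 2 : ℂ) • (1 + ((b : ℤ) : ℂ) • K x)

/-- A Bell functional in the correlator basis: `B s` is the coefficient of `⨂ v, K^{(v)}_{s v}`,
where `K^{(v)}_x` is the dichotomic operator of party `v` in setting `x`, encoded as `some x`, and
`none` stands for the identity operator. -/
abbrev BellFunctional (V : Type) := (V → Option (Fin 2)) → ℝ

section Bell

variable {V : Type} [Fintype V] [DecidableEq V]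

/-- The Bell operator `B[K]`. -/
def BellFunctional.op (B : BellFunctional V) {ι : V → Type*} (K : ∀ v, Fin 2 → Op (ι v)) :
    Op (∀ v, ι v) :=
  ∑ s : V → Option (Fin 2), (B s : ℂ) • tensorOp (fun v => (s v).elim 1 (K v))

/-- `-c ≤ B[K] ≤ c` for all measurement systems on all Hilbert spaces. -/
def BellFunctional.BoundedBy (c : ℝ) (B : BellFunctional V) : Prop :=
  ∀ (ι : V → Type u) (A : ∀ v, ℤˣ → Fin 2 → Op (ι v)), (∀ v, IsMeasurement (A v)) →
    ((c : ℂ) • 1 - B.op (fun v => correlator (A v))).IsPositive ∧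
    ((c : ℂ) • 1 + B.op (fun v => correlator (A v))).IsPositive

/-- The functional `⨂ v, K^{(v)}_{s v}`. -/
def mono (s : V → Option (Fin 2)) : BellFunctional V := Pi.single s 1

/-- The coefficients `B^{a|x}` of a Bell functional in terms of the POVM elements: `K_x` is
`∑_a a A_{a|x}` and the identity is written as `∑_a A_{a|0}`. -/
def BellFunctional.toTensor (B : BellFunctional V) (a : V → ℤˣ) (x : V → Fin 2) : ℝ :=
  ∑ s : V → Option (Fin 2), B s * ∏ v, (s v).elim (if x v = 0 then 1 else 0)
    (fun t => if x v = t then (((a v : ℤˣ) : ℤ) : ℝ) else 0)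

/-- The tensor of `C_{b|y} = (1 + b B_y) / 2`. -/
def connectorOf (B : Fin 2 → BellFunctional V) : ConnectorTensor V ℤˣ (Fin 2) ℤˣ (Fin 2) :=
  fun b y => BellFunctional.toTensor
    ((1 / 2 : ℝ) • (mono (fun _ => none) + ((b : ℤ) : ℝ) • B y))

/-- `|0⟩⟨φ| + |1⟩⟨φ'|`. -/
def coisometryOf {κ : Type*} (φ φ' : Hil κ) : Hil κ →L[ℂ] Hil (Fin 2) :=
  (innerSL ℂ φ).smulRight (ket 0) + (innerSL ℂ φ').smulRight (ket 1)

/-- The functionals `B 0`, `B 1` are normalized, `C_{b|y} = (1 + b B_y) / 2` defines a connector,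
and, with the qubit measurements with dichotomic operators `K` and the coisometry
`T = |0⟩⟨φ| + |1⟩⟨φ'|`, this is a connector complex with
`T C_{b|y}[A] T† = (1 + b S_y) / 2`. -/
structure GivesComplex (B : Fin 2 → BellFunctional V) (K : V → Fin 2 → Op (Fin 2))
    (φ φ' : Hil (V → Fin 2)) (S : Fin 2 → Op (Fin 2)) : Prop where
  normalized : ∀ y, BellFunctional.BoundedBy.{u} 1 (B y)
  connector_apply : ∀ (ι : V → Type u) (A : ∀ v, ℤˣ → Fin 2 → Op (ι v)),
    (∀ v, IsMeasurement (A v)) → ∀ b y, (connectorOf B).apply A b y =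
      (1 / 2 : ℂ) • (1 + ((b : ℤ) : ℂ) • (B y).op (fun v => correlator (A v)))
  isComplex : IsConnectorComplex.{u} (connectorOf B) (fun v => dichotomic (K v))
    (coisometryOf φ φ')
  renormalized_eq : ∀ b y, (connectorOf B).renormalized (fun v => dichotomic (K v))
    (coisometryOf φ φ') b y = (1 / 2 : ℂ) • (1 + ((b : ℤ) : ℂ) • S y)

end Bell

/-- The operator on `ℂⁿ` with matrix `M` in the standard basis. -/
def matOp {n : Type*} [Fintype n] [DecidableEq n] (M : Matrix n n ℂ) : Op n :=
  (lpPiLpₗᵢ (fun _ : n => ℂ) ℂ (p := 2)).symm.toContinuousLinearEquiv.toContinuousLinearMap ∘L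
    Matrix.toEuclideanCLM (n := n) (𝕜 := ℂ) M ∘L
    (lpPiLpₗᵢ (fun _ : n => ℂ) ℂ (p := 2)).toContinuousLinearEquiv.toContinuousLinearMap

/-- The Pauli operator `σ₁ = X`. -/
def σX : Op (Fin 2) := matOp !![0, 1; 1, 0]

/-- The Pauli operator `σ₂ = Y`. -/
def σY : Op (Fin 2) := matOp !![0, -Complex.I; Complex.I, 0]

/-- The Pauli operator `σ₃ = Z`. -/
def σZ : Op (Fin 2) := matOp !![1, 0; 0, -1]

/-! ### Two-party functionals -/

/-- `K^{(1)}_x ⊗ K^{(2)}_y`. -/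
def cor (x y : Fin 2) : BellFunctional (Fin 2) := mono ![some x, some y]

/-- `K^{(1)}_x ⊗ 1`. -/
def corFst (x : Fin 2) : BellFunctional (Fin 2) := mono ![some x, none]

namespace CHSH

/-- The functionals `B₀`, `B₁`. -/
def B : Fin 2 → BellFunctional (Fin 2) :=
  ![(1 / (2 * √2)) • (-cor 0 0 + cor 1 0 + cor 0 1 + cor 1 1),
    (1 / (2 * √2)) • (cor 0 0 + cor 1 0 + cor 0 1 - cor 1 1)]

def K : Fin 2 → Fin 2 → Op (Fin 2) :=
  ![![σZ, σX],
    ![((1 / √2 : ℝ) : ℂ) • (σZ + σX), ((1 / √2 : ℝ) : ℂ) • (σZ - σX)]]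

def φp : Hil (Fin 2 → Fin 2) := ((1 / √2 : ℝ) : ℂ) • (ket ![0, 0] + ket ![1, 1])

def φm : Hil (Fin 2 → Fin 2) := ((1 / √2 : ℝ) : ℂ) • (ket ![1, 0] - ket ![0, 1])

end CHSH

namespace Tilted

/-- `α(θ) = ± 2 (1 + 2 tan² 2θ)^(-1/2)` with the sign of `cos 2θ`, and `α(θ) = 0` where
`cos 2θ = 0` (the limit value). -/
def α (θ : ℝ) : ℝ := 2 * Real.sign (Real.cos (2 * θ)) / √(1 + 2 * Real.tan (2 * θ) ^ 2)

def β (θ : ℝ) : ℝ := √(8 + 2 * α θ ^ 2)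

def μ (θ : ℝ) : ℝ := Real.arctan (Real.sin (2 * θ))

/-- The functionals `B₀`, `B₁`. -/
def B (θ : ℝ) : Fin 2 → BellFunctional (Fin 2) :=
  ![(1 / β θ) • (α θ • corFst 1 - cor 0 0 + cor 1 0 + cor 0 1 + cor 1 1),
    (1 / β θ) • (α θ • corFst 0 + cor 0 0 + cor 1 0 + cor 0 1 - cor 1 1)]

def K (θ : ℝ) : Fin 2 → Fin 2 → Op (Fin 2) :=
  ![![σZ, σX],
    ![(Real.cos (μ θ) : ℂ) • σZ + (Real.sin (μ θ) : ℂ) • σX,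
      (Real.cos (μ θ) : ℂ) • σZ - (Real.sin (μ θ) : ℂ) • σX]]

def φp (θ : ℝ) : Hil (Fin 2 → Fin 2) :=
  (Real.cos θ : ℂ) • ket ![0, 0] + (Real.sin θ : ℂ) • ket ![1, 1]

def φm (θ : ℝ) : Hil (Fin 2 → Fin 2) :=
  (Real.cos θ : ℂ) • ket ![1, 0] - (Real.sin θ : ℂ) • ket ![0, 1]

end Tilted

namespace WBC

def β (θ φ ω : ℝ) : ℝ := Real.sin θ * Real.sin (ω - φ) * Real.sin (θ + φ + ω)

def B₁ (θ φ ω : ℝ) : BellFunctional (Fin 2) :=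
  (1 / β θ φ ω) •
    ((Real.cos (θ + φ) * Real.cos (θ + ω)) • (Real.cos ω • cor 0 0 - Real.cos φ • cor 0 1) +
     (Real.cos φ * Real.cos ω) • (Real.cos (θ + φ) • cor 1 1 - Real.cos (θ + ω) • cor 1 0))

/-- The functional with the two settings of each party exchanged. -/
def swapSettings {V : Type} (B : BellFunctional V) : BellFunctional V :=
  fun s => B (fun v => (s v).map (Equiv.swap 0 1))

/-- `B₀[K] = B₁[K^{(1)}_1, K^{(1)}_0, K^{(2)}_1, K^{(2)}_0]`. -/
def B (θ φ ω : ℝ) : Fin 2 → BellFunctional (Fin 2) :=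
  ![swapSettings (B₁ θ φ ω), B₁ θ φ ω]

/-- `cos t σ₁ + sin t σ₂`. -/
def equatorial (t : ℝ) : Op (Fin 2) := (Real.cos t : ℂ) • σX + (Real.sin t : ℂ) • σY

def K (θ φ ω : ℝ) : Fin 2 → Fin 2 → Op (Fin 2) :=
  ![![σX, equatorial θ], ![equatorial φ, equatorial ω]]

def φp : Hil (Fin 2 → Fin 2) := ((1 / √2 : ℝ) : ℂ) • (ket ![0, 0] + Complex.I • ket ![1, 1])

def φm : Hil (Fin 2 → Fin 2) := ((1 / √2 : ℝ) : ℂ) • (ket ![0, 0] - Complex.I • ket ![1, 1])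

end WBC

/-! ### Graph states -/

namespace BASTA

variable {V : Type} [Fintype V] [DecidableEq V] (G : SimpleGraph V) [DecidableRel G.Adj]

/-- `K_x^{(i)} ⨂_{j ∈ n(i)} K_1^{(j)}`. -/
def centralTerm (i : V) (x : Fin 2) : BellFunctional V :=
  mono fun v => if v = i then some x else if G.Adj i v then some 1 else none

/-- `K_x^{(i)} ⊗ K_0^{(j)} ⨂_{k ∈ n(j), k ≠ i} K_1^{(k)}`. -/
def neighbourTerm (i j : V) (x : Fin 2) : BellFunctional V :=
  mono fun v => if v = i then some x else if v = j then some 0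
    else if G.Adj j v then some 1 else none

/-- `K_0^{(j)} ⨂_{k ∈ n(j)} K_1^{(k)}`. -/
def farTerm (j : V) : BellFunctional V :=
  mono fun v => if v = j then some 0 else if G.Adj j v then some 1 else none

/-- The functional `B(G, i)`. -/
def B (i : V) : BellFunctional V :=
  (G.degree i : ℝ) • (centralTerm G i 0 + centralTerm G i 1)
    + ∑ j ∈ G.neighborFinset i, (neighbourTerm G i j 0 - neighbourTerm G i j 1)
    + ∑ j with j ≠ i ∧ ¬ G.Adj i j, farTerm G j

/-- `K_x^{(i)} ⨂_{j ≠ i} K_1^{(j)}`. -/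
def fullTerm (i : V) (x : Fin 2) : BellFunctional V :=
  mono fun v => if v = i then some x else some 1

/-- `K_x^{(i)} ⊗ K_0^{(j)} ⨂_{k ∈ EN} K_1^{(k)}`, where `EN` is the set of the vertices that are
neighbours of both `i` and `j` or of neither (which excludes `i` and `j` if they are adjacent). -/
def evenTerm (i j : V) (x : Fin 2) : BellFunctional V :=
  mono fun v => if v = i then some x else if v = j then some 0
    else if (G.Adj i v ↔ G.Adj j v) then some 1 else none

/-- The functional `B'(G, i)`. -/
def B' (i : V) : BellFunctional V :=
  (G.degree i : ℝ) • (fullTerm i 0 - fullTerm i 1)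
    - ∑ j ∈ G.neighborFinset i, (evenTerm G i j 0 + evenTerm G i j 1)

def β₁ (i : V) : ℝ := (2 * √2 - 1) * G.degree i + Fintype.card V - 1

def β₀ (i : V) : ℝ := 2 * √2 * G.degree i

/-- The normalized functionals `B₀`, `B₁`. -/
def normalizedB (i : V) : Fin 2 → BellFunctional V :=
  ![(1 / β₀ G i) • B' G i, (1 / β₁ G i) • B G i]

/-- `K_0 = (X + Z)/√2`, `K_1 = (X - Z)/√2` at the vertex `i`, and `K_0 = X`, `K_1 = Z` elsewhere. -/
def K (i v : V) : Fin 2 → Op (Fin 2) :=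
  if v = i then ![((1 / √2 : ℝ) : ℂ) • (σX + σZ), ((1 / √2 : ℝ) : ℂ) • (σX - σZ)] else ![σX, σZ]

/-- The number of edges of `G` with both ends in `{v | x v = 1}`, that is, `∑_{ij ∈ E} x_i x_j`. -/
def edgeCount (x : V → Fin 2) : ℕ := (G.edgeFinset.filter fun e => ∀ v ∈ e, x v = 1).card

/-- The graph state `2^(-N/2) ∑_x (-1)^(∑_{ij ∈ E} x_i x_j) |x⟩`. -/
def φp : Hil (V → Fin 2) :=
  ((1 / √(2 ^ Fintype.card V) : ℝ) : ℂ) • ∑ x : V → Fin 2, (-1 : ℂ) ^ edgeCount G x • ket x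

/-- The antigraph state `2^(-N/2) ∑_x (-1)^(∑_{ij ∈ E} x_i x_j + ∑_i x_i) |x⟩`. -/
def φm : Hil (V → Fin 2) :=
  ((1 / √(2 ^ Fintype.card V) : ℝ) : ℂ) •
    ∑ x : V → Fin 2, (-1 : ℂ) ^ (edgeCount G x + ∑ v, (x v : ℕ)) • ket x

/-- The stabilizer operator `X_j ⨂_{k ∈ n(j)} Z_k`. -/
def stabilizer (j : V) : Op (V → Fin 2) :=
  tensorOp fun v => if v = j then σX else if G.Adj j v then σZ else 1

end BASTA

end

/-!
The operators `(1 ± B_y[K]) / 2` form a measurement exactly when `|B_y| ≤ 1`, so a pair of bounded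
functionals is a connector. For orthonormal `φ, φ'` the operator `V = |0⟩⟨φ| + |1⟩⟨φ'|` is a
coisometry, and `B_y[K̄] V† = V† S_y` gives `V B_y[K̄] V† = S_y`; it remains to bound the
functionals and to let them act on `φ` and `φ'`.

All bounds are sums of squares for commuting contractions. If `T` is the tilted CHSH expression and
`T'` is obtained from `T` by exchanging the settings `a₀, a₁` and negating `b`, then
`T² + T'² = 8 + 2α²` for reflections. The WBC weights factor as `l_x p_{xy}` with `l ≥ 0` and
`∑_x l_x p_x p_xᵀ` diagonal, and the bound is `∑_x l_x (a_x - ∑_y p_{xy} b_y)² ≥ 0`. The BASTA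
functionals are sums of CHSH expressions, with products of observables in place of single ones, and
of products of norm at most `1`.

On the states: CHSH is tilted CHSH at `θ = π / 4`. A product of equatorial observables with angles
adding up to `τ` maps `|00⟩` to `e^{iτ}|11⟩`, so a WBC operator depends only on the sums of its
weights against `cos τ` and `sin τ`; exchanging the settings replaces `τ` by `θ + φ + ω - τ`. The
BASTA operator `B` is a combination of graph-state stabilizers and `B'` one of products of an even
number of them with the parity `⨂ Z`, which exchanges the graph and the antigraph state.
-/

section AbsLE

variable {𝓐 : Type*} [CStarAlgebra 𝓐]

/-- The two-sided bound `-c ≤ a ≤ c` on a self-adjoint element `a` of a C⋆-algebra, encoded as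
`‖a‖ ≤ c` so that sums and products of such bounds come from the norm. -/
structure AbsLE (c : ℝ) (a : 𝓐) : Prop where
  isSelfAdjoint : IsSelfAdjoint a
  norm_le : ‖a‖ ≤ c

namespace AbsLE

variable {c d : ℝ} {a b : 𝓐}

theorem neg (ha : AbsLE c a) : AbsLE c (-a) :=
  ⟨ha.isSelfAdjoint.neg, (norm_neg a).trans_le ha.norm_le⟩

theorem add (ha : AbsLE c a) (hb : AbsLE d b) : AbsLE (c + d) (a + b) :=
  ⟨ha.isSelfAdjoint.add hb.isSelfAdjoint, norm_add_le_of_le ha.norm_le hb.norm_le⟩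

theorem sum {J : Type*} {s : Finset J} {c : J → ℝ} {a : J → 𝓐} (h : ∀ j ∈ s, AbsLE (c j) (a j)) :
    AbsLE (∑ j ∈ s, c j) (∑ j ∈ s, a j) :=
  ⟨isSelfAdjoint_sum _ fun j hj => (h j hj).isSelfAdjoint,
    norm_sum_le_of_le _ fun j hj => (h j hj).norm_le⟩

theorem smul (r : ℝ) (ha : AbsLE c a) : AbsLE (|r| * c) ((r : ℂ) • a) where
  isSelfAdjoint := by
    rw [Complex.coe_smul]
    exact (IsSelfAdjoint.all r).smul ha.isSelfAdjoint
  norm_le := by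
    rw [norm_smul, Complex.norm_real, Real.norm_eq_abs]
    exact mul_le_mul_of_nonneg_left ha.norm_le (abs_nonneg r)

variable [PartialOrder 𝓐] [StarOrderedRing 𝓐]

theorem smul_one_sub_nonneg (ha : AbsLE c a) : 0 ≤ c • 1 - a := by
  rw [sub_nonneg, ← Algebra.algebraMap_eq_smul_one]
  exact ha.isSelfAdjoint.le_algebraMap_norm_self.trans (algebraMap_mono 𝓐 ha.norm_le)

theorem smul_one_add_nonneg (ha : AbsLE c a) : 0 ≤ c • 1 + a := by
  simpa only [sub_neg_eq_add] using ha.neg.smul_one_sub_nonneg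

theorem mul_self_le_one (ha : AbsLE 1 a) : a * a ≤ 1 := by
  have h := CStarAlgebra.star_mul_le_algebraMap_norm_sq (a := a)
  rw [ha.isSelfAdjoint.star_eq] at h
  refine h.trans ?_
  rw [← map_one (algebraMap ℝ 𝓐)]
  exact algebraMap_mono 𝓐 (pow_le_one₀ (norm_nonneg _) ha.norm_le)

theorem of_mul_self_le (hc : 0 ≤ c) (ha : IsSelfAdjoint a) (h : a * a ≤ c ^ 2 • 1) :
    AbsLE c a := by
  refine ⟨ha, (sq_le_sq₀ (norm_nonneg a) hc).1 ?_⟩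
  rw [← Algebra.algebraMap_eq_smul_one] at h
  rw [← CStarAlgebra.norm_le_iff_le_algebraMap _ (sq_nonneg c) ha.mul_self_nonneg] at h
  rwa [pow_two ‖a‖, ← CStarRing.norm_star_mul_self, ha.star_eq]

theorem of_nonneg (hc : 0 ≤ c) (h₁ : 0 ≤ c • 1 - a) (h₂ : 0 ≤ c • 1 + a) : AbsLE c a := by
  have hsa : IsSelfAdjoint a := by
    simpa using (IsSelfAdjoint.of_nonneg h₂).sub ((IsSelfAdjoint.all c).smul (.one 𝓐))
  have hcomm : Commute (c • 1 - a) (c • 1 + a) :=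
    ((((Commute.one_left _).smul_left c)).sub_left
      (((Commute.one_right a).smul_right c).add_right (.refl a)))
  refine of_mul_self_le hc hsa (sub_nonneg.1 ?_)
  convert hcomm.mul_nonneg h₁ h₂ using 1
  simp only [sub_mul, mul_add, smul_mul_assoc, mul_smul_comm, one_mul, mul_one]
  module

end AbsLE

/-- The observables `a x` and `b y` of two parties: self-adjoint contractions, those of the first
party commuting with those of the second. -/
structure CommutingObservables {X Y : Type*} (a : X → 𝓐) (b : Y → 𝓐) : Prop where
  left : ∀ x, AbsLE 1 (a x)
  right : ∀ y, AbsLE 1 (b y)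
  commute : ∀ x y, Commute (a x) (b y)

namespace CommutingObservables

variable {X Y : Type*} {a : X → 𝓐} {b : Y → 𝓐}

theorem neg_left (h : CommutingObservables a b) : CommutingObservables (-a) b :=
  ⟨fun x => (h.left x).neg, h.right, fun x y => (h.commute x y).neg_left⟩

theorem isSelfAdjoint_mul (h : CommutingObservables a b) (x : X) (y : Y) :
    IsSelfAdjoint (a x * b y) :=
  ((h.left x).isSelfAdjoint.commute_iff (h.right y).isSelfAdjoint).1 (h.commute x y)

end CommutingObservables

end AbsLE

/-! ### The tilted CHSH bound -/

section TiltedCHSH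

variable {𝓐 : Type*} [CStarAlgebra 𝓐]

/-- The tilted CHSH expression `α a₀ + a₀ b₀ + a₁ b₀ + a₀ b₁ - a₁ b₁`, evaluated in an arbitrary
algebra; the case `α = 0` is the CHSH expression. -/
def tiltedCHSH (α : ℝ) (a b : Fin 2 → 𝓐) : 𝓐 :=
  (α : ℂ) • a 0 + a 0 * b 0 + a 1 * b 0 + a 0 * b 1 - a 1 * b 1

/-- If the `a x` and `b y` are reflections, only the first term on the right survives. -/
theorem tiltedCHSH_sos (α : ℝ) {a b : Fin 2 → 𝓐} (h : ∀ x y, Commute (a x) (b y)) :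
    (8 + 2 * α ^ 2) • 1 - tiltedCHSH α a b * tiltedCHSH α a b =
      tiltedCHSH α ![a 1, a 0] (-b) * tiltedCHSH α ![a 1, a 0] (-b) +
        ((2 : ℝ) • ((a 0 + a 1) * (1 - b 0 * b 0) * (a 0 + a 1)) +
          (2 : ℝ) • ((a 0 - a 1) * (1 - b 1 * b 1) * (a 0 - a 1))) +
        ((1 - a 0 * a 0) * ((4 + α ^ 2) • 1 + (2 * α) • (b 0 + b 1)) +
          (1 - a 1 * a 1) * ((4 + α ^ 2) • 1 + (2 * -α) • (b 0 + b 1))) := by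
  have move : ∀ x y, b y * a x = a x * b y := fun x y => (h x y).eq.symm
  have move_assoc : ∀ x y z, b y * (a x * z) = a x * (b y * z) := fun x y z => by
    rw [← mul_assoc, move, mul_assoc]
  simp only [tiltedCHSH, Complex.coe_smul, Matrix.cons_val_zero, Matrix.cons_val_one,
    Pi.neg_apply, mul_neg, neg_mul, mul_add, add_mul, mul_sub, sub_mul, smul_mul_assoc,
    mul_smul_comm, one_mul, mul_one, mul_assoc, move, move_assoc, smul_add, smul_sub]
  module

theorem isSelfAdjoint_tiltedCHSH (α : ℝ) {a b : Fin 2 → 𝓐} (h : CommutingObservables a b) :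
    IsSelfAdjoint (tiltedCHSH α a b) := by
  have hα : IsSelfAdjoint ((α : ℂ) • a 0) := ((h.left 0).smul α).isSelfAdjoint
  exact (((hα.add (h.isSelfAdjoint_mul 0 0)).add (h.isSelfAdjoint_mul 1 0)).add
    (h.isSelfAdjoint_mul 0 1)).sub (h.isSelfAdjoint_mul 1 1)

variable [PartialOrder 𝓐] [StarOrderedRing 𝓐]

theorem AbsLE.affine_nonneg (c : ℝ) {b₀ b₁ : 𝓐} (h₀ : AbsLE 1 b₀) (h₁ : AbsLE 1 b₁) :
    0 ≤ (4 + c ^ 2) • (1 : 𝓐) + (2 * c) • (b₀ + b₁) := by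
  have hsum : AbsLE (|2 * c| * (1 + 1)) (((2 * c : ℝ) : ℂ) • (b₀ + b₁)) := (h₀.add h₁).smul _
  have hsq : 0 ≤ (|c| - 2) ^ 2 • (1 : 𝓐) := smul_nonneg (sq_nonneg _) zero_le_one
  convert add_nonneg hsq hsum.smul_one_add_nonneg using 1
  rw [abs_mul, abs_two, sub_sq, sq_abs, Complex.coe_smul]
  module

theorem absLE_tiltedCHSH (α : ℝ) {a b : Fin 2 → 𝓐} (h : CommutingObservables a b) :
    AbsLE √(8 + 2 * α ^ 2) (tiltedCHSH α a b) := by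
  refine .of_mul_self_le (Real.sqrt_nonneg _) (isSelfAdjoint_tiltedCHSH α h) ?_
  rw [Real.sq_sqrt (by positivity), ← sub_nonneg, tiltedCHSH_sos α h.commute]
  have hsq : IsSelfAdjoint (tiltedCHSH α ![a 1, a 0] (-b)) :=
    isSelfAdjoint_tiltedCHSH α ⟨Fin.forall_fin_two.2 ⟨h.left 1, h.left 0⟩, fun y => (h.right y).neg,
      Fin.forall_fin_two.2 ⟨fun y => (h.commute 1 y).neg_right, fun y => (h.commute 0 y).neg_right⟩⟩
  have conj_nonneg : ∀ {s : 𝓐}, IsSelfAdjoint s → ∀ y,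
      0 ≤ (2 : ℝ) • (s * (1 - b y * b y) * s) := fun hs y =>
    smul_nonneg zero_le_two (hs.conjugate_nonneg (sub_nonneg.2 (h.right y).mul_self_le_one))
  have mul_nonneg : ∀ x (c : ℝ),
      0 ≤ (1 - a x * a x) * ((4 + c ^ 2) • (1 : 𝓐) + (2 * c) • (b 0 + b 1)) := fun x c => by
    have hcomm : Commute (a x) ((4 + c ^ 2) • (1 : 𝓐) + (2 * c) • (b 0 + b 1)) :=
      ((Commute.one_right _).smul_right _).add_right
        (((h.commute x 0).add_right (h.commute x 1)).smul_right _)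
    exact ((Commute.one_left _).sub_left (hcomm.mul_left hcomm)).mul_nonneg
      (sub_nonneg.2 (h.left x).mul_self_le_one) ((h.right 0).affine_nonneg c (h.right 1))
  have ha := (h.left 0).isSelfAdjoint.add (h.left 1).isSelfAdjoint
  have ha' := (h.left 0).isSelfAdjoint.sub (h.left 1).isSelfAdjoint
  exact add_nonneg
    (add_nonneg hsq.mul_self_nonneg (add_nonneg (conj_nonneg ha 0) (conj_nonneg ha' 1)))
    (add_nonneg (mul_nonneg 0 α) (by simpa only [neg_sq] using mul_nonneg 1 (-α)))

theorem absLE_chsh {a b : Fin 2 → 𝓐} (h : CommutingObservables a b) :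
    AbsLE (2 * √2) (a 0 * b 0 + a 1 * b 0 + a 0 * b 1 - a 1 * b 1) := by
  have hsqrt : √8 = 2 * √2 := by
    rw [show (8 : ℝ) = 2 ^ 2 * 2 by norm_num, Real.sqrt_mul (by norm_num),
      Real.sqrt_sq (by norm_num)]
  simpa [hsqrt, tiltedCHSH] using absLE_tiltedCHSH 0 h

end TiltedCHSH

/-! ### A bound on bipartite correlation expressions -/

section Correlation

variable {𝓐 X Y : Type*} [Fintype X] [Fintype Y]

theorem sum_smul_sum_mul_sum {R : Type*} [CommSemiring R] [Semiring 𝓐] [Algebra R 𝓐]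
    {l : X → R} {p : X → Y → R}
    (horth : ∀ y y', y ≠ y' → ∑ x, l x * p x y * p x y' = 0) (b : Y → 𝓐) :
    ∑ x, l x • ((∑ y, p x y • b y) * ∑ y, p x y • b y) =
      ∑ y, (∑ x, l x * p x y ^ 2) • (b y * b y) := by
  simp only [Finset.sum_mul_sum, Finset.smul_sum, smul_mul_smul_comm, smul_smul]
  rw [Finset.sum_comm]
  refine Finset.sum_congr rfl fun y _ => ?_
  rw [Finset.sum_comm]
  simp only [← Finset.sum_smul]
  rw [Finset.sum_eq_single y]
  · simp only [pow_two]
  · intro y' _ hy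
    simp only [← mul_assoc, horth y y' hy.symm, zero_smul]
  · simp

variable [CStarAlgebra 𝓐] [PartialOrder 𝓐] [StarOrderedRing 𝓐]

theorem two_smul_mul_le_of_commute {a q : 𝓐} (h : Commute a q) (ha : IsSelfAdjoint a)
    (hq : IsSelfAdjoint q) : (2 : ℝ) • (a * q) ≤ a * a + q * q := by
  rw [← sub_nonneg]
  convert (ha.sub hq).mul_self_nonneg using 1
  rw [mul_sub, sub_mul, sub_mul, ← h.eq]
  module

theorem sum_smul_mul_le {l : X → ℝ} {p : X → Y → ℝ} (hl : ∀ x, 0 ≤ l x)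
    (horth : ∀ y y', y ≠ y' → ∑ x, l x * p x y * p x y' = 0) {a : X → 𝓐} {b : Y → 𝓐}
    (h : CommutingObservables a b) :
    ∑ x, ∑ y, (l x * p x y) • (a x * b y) ≤
      ((∑ x, l x + ∑ y, ∑ x, l x * p x y ^ 2) / 2) • (1 : 𝓐) := by
  set q : X → 𝓐 := fun x => ∑ y, p x y • b y with hq
  have hqsa : ∀ x, IsSelfAdjoint (q x) := fun x =>
    isSelfAdjoint_sum _ fun y _ => (IsSelfAdjoint.all (p x y)).smul (h.right y).isSelfAdjoint
  have hcomm : ∀ x, Commute (a x) (q x) := fun x =>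
    Commute.sum_right _ _ _ fun y _ => (h.commute x y).smul_right _
  suffices htwo : (2 : ℝ) • ∑ x, l x • (a x * q x) ≤
      (∑ x, l x + ∑ y, ∑ x, l x * p x y ^ 2) • (1 : 𝓐) by
    have := smul_le_smul_of_nonneg_left htwo (one_half_pos (α := ℝ)).le
    simpa [hq, smul_smul, Finset.mul_sum, Finset.smul_sum, div_eq_inv_mul] using this
  calc (2 : ℝ) • ∑ x, l x • (a x * q x)
      = ∑ x, l x • (2 : ℝ) • (a x * q x) := by simp only [Finset.smul_sum, smul_comm (2 : ℝ)]
    _ ≤ ∑ x, l x • (a x * a x + q x * q x) := by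
        gcongr with x
        · exact hl x
        · exact two_smul_mul_le_of_commute (hcomm x) (h.left x).isSelfAdjoint (hqsa x)
    _ = ∑ x, l x • (a x * a x) + ∑ y, (∑ x, l x * p x y ^ 2) • (b y * b y) := by
        simp only [smul_add, Finset.sum_add_distrib, hq, sum_smul_sum_mul_sum horth]
    _ ≤ ∑ x, l x • 1 + ∑ y, (∑ x, l x * p x y ^ 2) • 1 := by
        gcongr with x _ y
        · exact hl x
        · exact (h.left x).mul_self_le_one
        · exact Finset.sum_nonneg fun x _ => mul_nonneg (hl x) (sq_nonneg _)
        · exact (h.right y).mul_self_le_one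
    _ = (∑ x, l x + ∑ y, ∑ x, l x * p x y ^ 2) • (1 : 𝓐) := by
        rw [← Finset.sum_smul, ← Finset.sum_smul, add_smul]

theorem absLE_sum_smul_mul {l : X → ℝ} {p : X → Y → ℝ} (hl : ∀ x, 0 ≤ l x)
    (horth : ∀ y y', y ≠ y' → ∑ x, l x * p x y * p x y' = 0) {a : X → 𝓐} {b : Y → 𝓐}
    (h : CommutingObservables a b) :
    AbsLE ((∑ x, l x + ∑ y, ∑ x, l x * p x y ^ 2) / 2)
      (∑ x, ∑ y, ((l x * p x y : ℝ) : ℂ) • (a x * b y)) := by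
  simp only [Complex.coe_smul]
  refine .of_nonneg ?_ (sub_nonneg.2 (sum_smul_mul_le hl horth h)) ?_
  · exact div_nonneg (add_nonneg (Finset.sum_nonneg fun x _ => hl x)
      (Finset.sum_nonneg fun y _ => Finset.sum_nonneg fun x _ =>
        mul_nonneg (hl x) (sq_nonneg _))) zero_le_two
  · simpa using sub_nonneg.2 (sum_smul_mul_le hl horth h.neg_left)

end Correlation

/-! ### Tensor products of operators -/

theorem inner_ket {ι : Type*} (i : ι) (f : Hil ι) : inner ℂ (ket i) f = f i := by
  simp [ket, lp.inner_single_left]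

theorem op_ext_entries {ι κ : Type*} {S T : Hil ι →L[ℂ] Hil κ}
    (h : ∀ i j, (S (ket j)) i = (T (ket j)) i) : S = T :=
  op_ext_ket fun j => lp.ext (funext fun i => h i j)

theorem adjoint_ket_apply {ι κ : Type*} (T : Hil ι →L[ℂ] Hil κ) (i : ι) (j : κ) :
    (T.adjoint (ket j)) i = star ((T (ket i)) j) := by
  rw [← inner_ket, ContinuousLinearMap.adjoint_inner_right, ← inner_conj_symm, inner_ket]
  rfl

/-- The matrix element `⟨i| T |j⟩`, as a linear functional of the operator `T`. -/
noncomputable def matrixElement {ι : Type*} (i j : ι) : Op ι →ₗ[ℂ] ℂ where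
  toFun T := (T (ket j)) i
  map_add' _ _ := rfl
  map_smul' _ _ := rfl

theorem induction_on_update {V : Type*} [Finite V] [DecidableEq V] {M : V → Type*}
    {P : (∀ v, M v) → Prop} (base : ∀ v, M v) (hbase : P base)
    (step : ∀ k A, P (Function.update A k (base k)) → P A) (A : ∀ v, M v) : P A := by
  have := Fintype.ofFinite V
  suffices h : ∀ s : Finset V, P fun v => if v ∈ s then A v else base v by
    simpa using h Finset.univ
  intro s
  induction s using Finset.induction_on with
  | empty => simpa using hbase
  | insert k s hk ih =>
    refine step k _ ?_
    convert ih using 1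
    funext v
    rcases eq_or_ne v k with rfl | hv
    · simp [hk]
    · simp [hv]

section Tensor

variable {V : Type*} [Fintype V] {ι : V → Type*}

theorem prod_ket_apply (i j : ∀ v, ι v) : ∏ v, (ket (j v)) (i v) = (ket j) i := by
  classical
  simp [ket_apply, Finset.prod_ite_zero, funext_iff]

theorem tensorOp_ket_of_monomial {A : ∀ v, Op (ι v)} {x x' : ∀ v, ι v} {c : V → ℂ}
    (h : ∀ v, A v (ket (x v)) = c v • ket (x' v)) :
    tensorOp A (ket x) = (∏ v, c v) • ket x' := by
  ext i
  have hentry : ∀ v, (A v (ket (x v))) (i v) = c v * (ket (x' v)) (i v) := fun v => by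
    rw [h]
    rfl
  rw [tensorOp_ket, Finset.prod_congr rfl fun v _ => hentry v, Finset.prod_mul_distrib,
    prod_ket_apply]
  rfl

theorem tensorOp_one : tensorOp (fun v => (1 : Op (ι v))) = 1 :=
  op_ext_ket fun j => by
    simpa using tensorOp_ket_of_monomial (A := fun _ => 1) (x := j) (x' := j) (c := 1)
      fun v => (one_smul ℂ (ket (j v))).symm

theorem star_tensorOp (A : ∀ v, Op (ι v)) :
    star (tensorOp A) = tensorOp fun v => star (A v) := by
  refine op_ext_entries fun i j => ?_
  simp only [ContinuousLinearMap.star_eq_adjoint, adjoint_ket_apply, tensorOp_ket, star_prod]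

/-- The tensor product of operators as a multilinear map. -/
noncomputable def tensorMap (ι : V → Type*) :
    MultilinearMap ℂ (fun v => Op (ι v)) (Op (∀ v, ι v)) where
  toFun := tensorOp
  map_update_add' A k M N := op_ext_entries fun i j => by
    have h := ((MultilinearMap.mkPiAlgebra ℂ V ℂ).compLinearMap
      fun v => matrixElement (i v) (j v)).map_update_add A k M N
    simp only [add_apply, lp.coeFn_add, Pi.add_apply, tensorOp_ket]
    exact h
  map_update_smul' A k c M := op_ext_entries fun i j => by
    have h := ((MultilinearMap.mkPiAlgebra ℂ V ℂ).compLinearMap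
      fun v => matrixElement (i v) (j v)).map_update_smul A k c M
    simp only [smul_apply, lp.coeFn_smul, Pi.smul_apply, tensorOp_ket]
    exact h

theorem tensorMap_apply (A : ∀ v, Op (ι v)) : tensorMap ι A = tensorOp A := rfl

theorem tensorOp_eq_neg {A B : ∀ v, Op (ι v)} (k : V) (hk : A k = -B k)
    (h : ∀ v ≠ k, A v = B v) : tensorOp A = -tensorOp B := by
  classical
  have hA : A = Function.update B k ((-1 : ℂ) • B k) := by
    rw [Function.eq_update_iff, neg_one_smul]
    exact ⟨hk, h⟩
  rw [hA, ← tensorMap_apply, MultilinearMap.map_update_smul, Function.update_eq_self,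
    neg_one_smul, tensorMap_apply]

theorem lineRestrict_tensorOp_ket [DecidableEq V] (k : V) (A : ∀ v, Op (ι v)) (i j : ∀ v, ι v) :
    lineRestrict k i (tensorOp A (ket j)) =
      (∏ v ∈ Finset.univ.erase k, (A v (ket (j v))) (i v)) • A k (ket (j k)) := by
  ext t
  rw [lineRestrict_apply, tensorOp_ket, ← Finset.prod_erase_mul _ _ (Finset.mem_univ k),
    Function.update_self, lp.coeFn_smul, Pi.smul_apply, smul_eq_mul]
  congr 1
  exact Finset.prod_congr rfl fun v hv => by rw [Function.update_of_ne (Finset.ne_of_mem_erase hv)]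

theorem leg_mul_tensorOp [DecidableEq V] (k : V) (M : Op (ι k)) (A : ∀ v, Op (ι v)) :
    leg k M * tensorOp A = tensorOp (Function.update A k (M * A k)) := by
  refine op_ext_entries fun i j => ?_
  rw [mul_apply_eq_comp, leg_apply, lineRestrict_tensorOp_ket, map_smul, tensorOp_ket,
    ← Finset.prod_erase_mul _ _ (Finset.mem_univ k), Function.update_self, lp.coeFn_smul,
    Pi.smul_apply, smul_eq_mul, mul_apply_eq_comp]
  congr 1
  exact Finset.prod_congr rfl fun v hv => by rw [Function.update_of_ne (Finset.ne_of_mem_erase hv)]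

theorem tensorOp_eq_leg_mul [DecidableEq V] (k : V) (A : ∀ v, Op (ι v)) :
    tensorOp A = leg k (A k) * tensorOp (Function.update A k 1) := by
  rw [leg_mul_tensorOp, Function.update_self, mul_one, Function.update_idem,
    Function.update_eq_self]

theorem tensorOp_mul (A B : ∀ v, Op (ι v)) :
    tensorOp A * tensorOp B = tensorOp fun v => A v * B v := by
  classical
  induction A using induction_on_update (fun v => (1 : Op (ι v))) with
  | hbase => simp only [tensorOp_one, one_mul]
  | step k A ih =>
    rw [tensorOp_eq_leg_mul k A, mul_assoc, ih, leg_mul_tensorOp]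
    congr 1
    funext v
    rcases eq_or_ne v k with rfl | hv
    · simp
    · simp [hv]

theorem norm_tensorOp_le_one {A : ∀ v, Op (ι v)} (hA : ∀ v, ‖A v‖ ≤ 1) :
    ‖tensorOp A‖ ≤ 1 := by
  classical
  induction A using induction_on_update (fun v => (1 : Op (ι v))) with
  | hbase =>
    rw [tensorOp_one]
    exact ContinuousLinearMap.norm_id_le
  | step k A ih =>
    have hleg : ‖leg k (A k)‖ ≤ ‖A k‖ := LinearMap.mkContinuous_norm_le _ (norm_nonneg _) _
    rw [tensorOp_eq_leg_mul k A]
    refine (norm_mul_le _ _).trans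
      (mul_le_one₀ (hleg.trans (hA k)) (norm_nonneg _) (ih fun v => ?_))
    rcases eq_or_ne v k with rfl | hv
    · rw [Function.update_self]
      exact ContinuousLinearMap.norm_id_le
    · simpa only [Function.update_of_ne hv] using hA v

theorem absLE_tensorOp {A : ∀ v, Op (ι v)} (hA : ∀ v, AbsLE 1 (A v)) : AbsLE 1 (tensorOp A) where
  isSelfAdjoint := (star_tensorOp A).trans
    (congrArg tensorOp (funext fun v => (hA v).isSelfAdjoint.star_eq))
  norm_le := norm_tensorOp_le_one fun v => (hA v).norm_le

end Tensor

/-! ### Bell operators -/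

section BellOperator

variable {V : Type} [Fintype V] [DecidableEq V] {ι : V → Type*}

/-- The Bell operator `B[K]` as a map of the Bell functional `B`; it is semilinear because the
coefficients of a functional are real. -/
noncomputable def BellFunctional.opLinear (K : ∀ v, Fin 2 → Op (ι v)) :
    BellFunctional V →ₛₗ[Complex.ofRealHom] Op (∀ v, ι v) where
  toFun B := B.op K
  map_add' B B' := by
    simp only [BellFunctional.op, Pi.add_apply, Complex.ofReal_add, add_smul,
      Finset.sum_add_distrib]
  map_smul' c B := by
    simp only [BellFunctional.op, Pi.smul_apply, smul_eq_mul, Complex.ofReal_mul, mul_smul,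
      Finset.smul_sum, Complex.ofRealHom_eq_coe]

namespace BellFunctional

variable (K : ∀ v, Fin 2 → Op (ι v)) (B B' : BellFunctional V)

theorem op_add : (B + B').op K = B.op K + B'.op K := map_add (opLinear K) B B'

theorem op_sub : (B - B').op K = B.op K - B'.op K := map_sub (opLinear K) B B'

theorem op_neg : (-B).op K = -B.op K := map_neg (opLinear K) B

theorem op_smul (c : ℝ) : (c • B).op K = (c : ℂ) • B.op K := map_smulₛₗ (opLinear K) c B

theorem op_sum {J : Type*} (s : Finset J) (B : J → BellFunctional V) :
    BellFunctional.op (∑ j ∈ s, B j) K = ∑ j ∈ s, (B j).op K := map_sum (opLinear K) B s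

theorem op_mono (s : V → Option (Fin 2)) :
    (mono s).op K = tensorOp fun v => (s v).elim 1 (K v) := by
  rw [BellFunctional.op, Finset.sum_eq_single s]
  · simp [mono]
  · intro t _ ht
    simp [mono, ht]
  · simp

theorem op_mono_mul {s t : V → Option (Fin 2)} (h : ∀ v, s v = none ∨ t v = none) :
    (mono s).op K * (mono t).op K = (mono fun v => (s v).or (t v)).op K := by
  simp only [op_mono, tensorOp_mul]
  congr 1
  funext v
  rcases h v with h | h <;> simp [h]

theorem commute_op_mono {s t : V → Option (Fin 2)} (h : ∀ v, s v = none ∨ t v = none) :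
    Commute ((mono s).op K) ((mono t).op K) := by
  refine (op_mono_mul K h).trans (Eq.trans ?_ (op_mono_mul K fun v => (h v).symm).symm)
  congr 2
  funext v
  rcases h v with h | h <;> simp [h]

variable {K}

theorem absLE_op_mono (hK : ∀ v x, AbsLE 1 (K v x)) (s : V → Option (Fin 2)) :
    AbsLE 1 ((mono s).op K) := by
  rw [op_mono]
  refine absLE_tensorOp fun v => ?_
  cases s v with
  | none => exact ⟨.one _, ContinuousLinearMap.norm_id_le⟩
  | some x => exact hK v x

end BellFunctional

end BellOperator

section Measurement

theorem sum_units_int {M : Type*} [AddCommMonoid M] (f : ℤˣ → M) : ∑ a, f a = f 1 + f (-1) := by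
  rw [show (Finset.univ : Finset ℤˣ) = {1, -1} from rfl, Finset.sum_pair (by decide)]

variable {ι : Type*} {A : ℤˣ → Fin 2 → Op ι}

theorem absLE_correlator (hA : IsMeasurement A) (x : Fin 2) : AbsLE 1 (correlator A x) := by
  have hsum : A 1 x + A (-1) x = 1 := (sum_units_int fun a => A a x).symm.trans (hA.2 x)
  have hnonneg : ∀ a, 0 ≤ A a x := fun a =>
    (ContinuousLinearMap.nonneg_iff_isPositive _).2 (hA.1 a x)
  refine .of_nonneg zero_le_one ?_ ?_
  · convert add_nonneg (hnonneg (-1)) (hnonneg (-1)) using 1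
    rw [← Complex.coe_smul, Complex.ofReal_one, one_smul, ← hsum, correlator]
    abel
  · convert add_nonneg (hnonneg 1) (hnonneg 1) using 1
    rw [← Complex.coe_smul, Complex.ofReal_one, one_smul, ← hsum, correlator]
    abel

/-- The coefficient of the POVM element `A_{a|x}` in the dichotomic operator `K_t`, if `s = some t`,
and in the identity operator, written as `∑ a, A_{a|0}`, if `s = none`. -/
def slotWeight (s : Option (Fin 2)) (a : ℤˣ) (x : Fin 2) : ℝ :=
  s.elim (if x = 0 then 1 else 0) fun t => if x = t then ((a : ℤ) : ℝ) else 0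

theorem sum_slotWeight_smul (hA : IsMeasurement A) (s : Option (Fin 2)) :
    ∑ a : ℤˣ, ∑ x : Fin 2, (slotWeight s a x : ℂ) • A a x = s.elim 1 (correlator A) := by
  cases s with
  | none => simpa [slotWeight, sum_units_int, -Complex.coe_smul] using hA.2 0
  | some t =>
    rw [sum_units_int]
    fin_cases t <;> simp [slotWeight, correlator, sub_eq_add_neg, -Complex.coe_smul]

end Measurement

/-! ### The connector of a pair of bounded Bell functionals -/

section ConnectorOf

variable {V : Type} [Fintype V] [DecidableEq V]

theorem BellFunctional.BoundedBy.of_absLE {c : ℝ} {B : BellFunctional V}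
    (h : ∀ (ι : V → Type u) (K : ∀ v, Fin 2 → Op (ι v)), (∀ v x, AbsLE 1 (K v x)) →
      AbsLE c (B.op K)) :
    BellFunctional.BoundedBy.{u} c B := by
  intro ι A hA
  have hB := h ι (fun v => correlator (A v)) fun v => absLE_correlator (hA v)
  simp only [← ContinuousLinearMap.nonneg_iff_isPositive, Complex.coe_smul]
  exact ⟨hB.smul_one_sub_nonneg, hB.smul_one_add_nonneg⟩

variable {ι : V → Type*} {A : ∀ v, ℤˣ → Fin 2 → Op (ι v)}

theorem op_mono_correlator (hA : ∀ v, IsMeasurement (A v)) (s : V → Option (Fin 2)) :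
    (mono s).op (fun v => correlator (A v)) =
      ∑ a : V → ℤˣ, ∑ x : V → Fin 2, ((∏ v, slotWeight (s v) (a v) (x v) : ℝ) : ℂ) •
        tensorOp fun v => A v (a v) (x v) := by
  simp only [BellFunctional.op_mono, ← sum_slotWeight_smul (hA _), ← tensorMap_apply,
    MultilinearMap.map_sum, MultilinearMap.map_smul_univ, Complex.ofReal_prod]

theorem sum_toTensor_smul (B : BellFunctional V) (hA : ∀ v, IsMeasurement (A v)) :
    ∑ a : V → ℤˣ, ∑ x : V → Fin 2, (B.toTensor a x : ℂ) • tensorOp (fun v => A v (a v) (x v)) =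
      B.op fun v => correlator (A v) := by
  have htensor : ∀ a x, (B.toTensor a x : ℂ) =
      ∑ s, (B s : ℂ) * ((∏ v, slotWeight (s v) (a v) (x v) : ℝ) : ℂ) := fun a x => by
    rw [BellFunctional.toTensor, Complex.ofReal_sum]
    exact Finset.sum_congr rfl fun s _ => Complex.ofReal_mul _ _
  rw [BellFunctional.op]
  simp only [← BellFunctional.op_mono, op_mono_correlator hA, htensor, Finset.smul_sum,
    Finset.sum_smul, mul_smul]
  exact Finset.sum_comm_cycle

theorem connectorOf_apply (B : Fin 2 → BellFunctional V) (hA : ∀ v, IsMeasurement (A v)) (b : ℤˣ)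
    (y : Fin 2) :
    (connectorOf B).apply A b y =
      (1 / 2 : ℂ) • (1 + ((b : ℤ) : ℂ) • (B y).op fun v => correlator (A v)) := by
  refine (sum_toTensor_smul _ hA).trans ?_
  simp only [BellFunctional.op_smul, BellFunctional.op_add, BellFunctional.op_mono,
    Option.elim_none, tensorOp_one, Complex.ofReal_div, Complex.ofReal_one, Complex.ofReal_ofNat,
    Complex.ofReal_intCast]

end ConnectorOf

section Connector

variable {V : Type} [Fintype V] [DecidableEq V] {B : Fin 2 → BellFunctional V}

theorem isMeasurement_connectorOf_apply (hB : ∀ y, BellFunctional.BoundedBy.{u} 1 (B y))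
    {ι : V → Type u} {A : ∀ v, ℤˣ → Fin 2 → Op (ι v)} (hA : ∀ v, IsMeasurement (A v)) :
    IsMeasurement ((connectorOf B).apply A) := by
  refine ⟨fun b y => ?_, fun y => ?_⟩
  · obtain ⟨hsub, hadd⟩ := hB y ι A hA
    rw [connectorOf_apply B hA]
    refine ContinuousLinearMap.IsPositive.smul_of_nonneg ?_ (by simp [Complex.nonneg_iff])
    rcases Int.units_eq_one_or b with rfl | rfl
    · simpa using hadd
    · simpa [sub_eq_add_neg] using hsub
  · simp only [sum_units_int, connectorOf_apply B hA, Units.val_one, Int.cast_one, Units.val_neg,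
      Int.cast_neg]
    module

end Connector

/-- The unitary `ℓ²(α) ≃ ℓ²(β)` relabelling the standard basis along a bijection `α ≃ β`. -/
noncomputable def hilReindex {α β : Type*} (e : α ≃ β) : Hil α ≃ₗᵢ[ℂ] Hil β where
  toFun f := ⟨fun b => f (e.symm b), memℓp_gen
    (((lp.memℓp f).summable (by norm_num)).comp_injective e.symm.injective)⟩
  invFun f := ⟨fun a => f (e a), memℓp_gen
    (((lp.memℓp f).summable (by norm_num)).comp_injective e.injective)⟩
  map_add' _ _ := rfl
  map_smul' _ _ := rfl
  left_inv f := by ext a; exact congrArg f (e.symm_apply_apply a)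
  right_inv f := by ext a; exact congrArg f (e.apply_symm_apply a)
  norm_map' f := by
    have hp : 0 < (2 : ℝ≥0∞).toReal := by norm_num
    rw [lp.norm_eq_tsum_rpow hp, lp.norm_eq_tsum_rpow hp]
    congr 1
    exact e.symm.tsum_eq fun a => ‖f a‖ ^ (2 : ℝ≥0∞).toReal

theorem hilReindex_apply {α β : Type*} (e : α ≃ β) (f : Hil α) (b : β) :
    (hilReindex e f) b = f (e.symm b) := rfl

theorem hilReindex_ket {α β : Type*} (e : α ≃ β) (a : α) :
    hilReindex e (ket a) = ket (e a) := by
  classical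
  ext b
  rw [hilReindex_apply, ket_apply, ket_apply]
  simp only [Equiv.symm_apply_eq]

theorem apply_hilReindex {α β : Type*} (e : α ≃ β) {S : Op α} {T : Op β}
    (h : ∀ i j, (T (ket (e j))) (e i) = (S (ket j)) i) (f : Hil α) :
    T (hilReindex e f) = hilReindex e (S f) := by
  have hcomp : T ∘L (hilReindex e).toContinuousLinearEquiv.toContinuousLinearMap =
      (hilReindex e).toContinuousLinearEquiv.toContinuousLinearMap ∘L S := by
    refine op_ext_entries fun b j => ?_
    change (T (hilReindex e (ket j))) b = (hilReindex e (S (ket j))) b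
    rw [hilReindex_ket, hilReindex_apply, ← h, Equiv.apply_symm_apply]
  exact congrArg (fun F => F f) hcomp

/-- The bijection of index sets that groups the parties `V` into a single party. -/
def groupLeft {V W : Type} (ι : V → Type u) (κ : W → Type u) :
    (∀ s : V ⊕ W, Sum.elim ι κ s) ≃ ∀ s : Unit ⊕ W, Sum.elim (fun _ : Unit => ∀ v, ι v) κ s where
  toFun f
    | Sum.inl _ => fun v => f (Sum.inl v)
    | Sum.inr w => f (Sum.inr w)
  invFun g
    | Sum.inl v => g (Sum.inl ()) v
    | Sum.inr w => g (Sum.inr w)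
  left_inv f := by
    funext s
    cases s <;> rfl
  right_inv g := by
    funext s
    cases s <;> rfl

section Group

variable {V W : Type} [Fintype V] [Fintype W] {ι : V → Type u} {κ : W → Type u}

theorem tensorOp_joinOps_groupLeft (A : ∀ v, Op (ι v)) (D : ∀ w, Op (κ w))
    (f : Hil (∀ s : V ⊕ W, Sum.elim ι κ s)) :
    tensorOp (joinOps (fun _ : Unit => tensorOp A) D) (hilReindex (groupLeft ι κ) f) =
      hilReindex (groupLeft ι κ) (tensorOp (joinOps A D) f) := by
  refine apply_hilReindex _ (fun i j => ?_) f
  rw [tensorOp_ket, tensorOp_ket, Fintype.prod_sum_type, Fintype.prod_sum_type,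
    Fintype.prod_unique]
  congr 1
  exact tensorOp_ket A (fun v => i (Sum.inl v)) (fun v => j (Sum.inl v))

open Classical in
/-- The operator `M ⊗ ⨂ w, D w` as a linear function of `M`. -/
noncomputable def tensorRight (η : Type u) (D : ∀ w, Op (κ w)) :
    Op η →ₗ[ℂ] Op (∀ s : Unit ⊕ W, Sum.elim (fun _ => η) κ s) :=
  (tensorMap (Sum.elim (fun _ : Unit => η) κ)).toLinearMap
    (joinOps (fun _ : Unit => (0 : Op η)) D) (Sum.inl ())

theorem tensorRight_apply (η : Type u) (D : ∀ w, Op (κ w)) (M : Op η) :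
    tensorRight η D M = tensorOp (joinOps (fun _ : Unit => M) D) := by
  classical
  change tensorOp _ = _
  congr 1
  funext s
  cases s with
  | inl t => exact Function.update_self _ _ _
  | inr w => exact Function.update_of_ne (by simp) _ _

end Group

section Connector

variable {V : Type} [Fintype V] [DecidableEq V] {B : Fin 2 → BellFunctional V}

theorem inner_connectorOf_apply_groupLeft {W : Type} [Fintype W] {ι : V → Type u} {κ : W → Type u}
    (B : Fin 2 → BellFunctional V) (A : ∀ v, ℤˣ → Fin 2 → Op (ι v)) (D : ∀ w, Op (κ w)) (b : ℤˣ)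
    (y : Fin 2) (f : Hil (∀ s : V ⊕ W, Sum.elim ι κ s)) :
    inner ℂ (hilReindex (groupLeft ι κ) f)
        (tensorOp (joinOps (fun _ : Unit => (connectorOf B).apply A b y) D)
          (hilReindex (groupLeft ι κ) f)) =
      ∑ a, ∑ x, (connectorOf B b y a x : ℂ) *
        inner ℂ f (tensorOp (joinOps (fun v => A v (a v) (x v)) D) f) := by
  rw [← tensorRight_apply, ConnectorTensor.apply]
  simp only [map_sum, map_smul, tensorRight_apply, sum_apply, smul_apply, inner_sum,
    inner_smul_right, tensorOp_joinOps_groupLeft, LinearIsometryEquiv.inner_map_map]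

theorem isConnector_connectorOf (hB : ∀ y, BellFunctional.BoundedBy.{u} 1 (B y)) :
    ConnectorTensor.IsConnector.{u} (connectorOf B) := by
  refine ⟨?_, fun ι A hA => (isMeasurement_connectorOf_apply hB hA).2⟩
  rintro W O' X' _ _ P ⟨ι, κ, A, D, ψ, hA, hD, hψ, hP⟩
  refine ⟨fun _ => ∀ v, ι v, κ, fun _ => (connectorOf B).apply A, D,
    fun n => hilReindex (groupLeft ι κ) (ψ n), fun _ => isMeasurement_connectorOf_apply hB hA, hD,
    by simpa only [LinearIsometryEquiv.norm_map] using hψ, fun b y c z => ?_⟩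
  push_cast
  refine (hasSum_sum fun a _ => hasSum_sum fun x _ =>
    (hP a x c z).mul_left (connectorOf B (b ()) (y ()) a x : ℂ)).congr_fun fun n => ?_
  exact inner_connectorOf_apply_groupLeft B A _ (b ()) (y ()) (ψ n)

end Connector

/-! ### Connector complexes from pairs of orthonormal vectors -/

section Reflection

/-- A self-adjoint element squaring to `1`: an observable with sharp values `±1`. -/
structure IsReflection {R : Type*} [Monoid R] [StarMul R] (a : R) : Prop where
  isSelfAdjoint : IsSelfAdjoint a
  mul_self : a * a = 1

theorem IsReflection.smul_add_smul {𝓐 : Type*} [CStarAlgebra 𝓐] {a b : 𝓐} (ha : IsReflection a)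
    (hb : IsReflection b) (hab : a * b + b * a = 0) {r s : ℝ} (hrs : r ^ 2 + s ^ 2 = 1) :
    IsReflection ((r : ℂ) • a + (s : ℂ) • b) where
  isSelfAdjoint := by
    simp only [Complex.coe_smul]
    exact ((IsSelfAdjoint.all r).smul ha.isSelfAdjoint).add
      ((IsSelfAdjoint.all s).smul hb.isSelfAdjoint)
  mul_self := by
    have hrs' : (r : ℂ) ^ 2 + (s : ℂ) ^ 2 = 1 := by exact_mod_cast hrs
    simp only [add_mul, mul_add, smul_mul_assoc, mul_smul_comm, ha.mul_self, hb.mul_self]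
    linear_combination (norm := module) ((r : ℂ) * s) • hab + hrs' • (1 : 𝓐)

theorem IsReflection.neg {R : Type*} [Ring R] [StarRing R] {a : R} (ha : IsReflection a) :
    IsReflection (-a) :=
  ⟨ha.isSelfAdjoint.neg, by rw [neg_mul_neg, ha.mul_self]⟩

end Reflection

section Dichotomic

variable {ι : Type*} {K : Fin 2 → Op ι}

theorem IsProjectiveMeasurement.isMeasurement {O X : Type*} [Fintype O] {M : O → X → Op ι}
    (hM : IsProjectiveMeasurement M) : IsMeasurement M :=
  ⟨fun a x => (ContinuousLinearMap.nonneg_iff_isPositive _).1 (hM.1 a x).nonneg, hM.2⟩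

theorem isProjectiveMeasurement_dichotomic (hK : ∀ x, IsReflection (K x)) :
    IsProjectiveMeasurement (dichotomic K) := by
  refine ⟨fun b x => ⟨?_, ?_⟩, fun x => ?_⟩
  · have hb : (((b : ℤ) : ℂ)) * ((b : ℤ) : ℂ) = 1 := by
      rcases Int.units_eq_one_or b with rfl | rfl <;> simp
    simp only [IsIdempotentElem, dichotomic, smul_mul_assoc, mul_smul_comm, add_mul, mul_add,
      one_mul, mul_one, (hK x).mul_self, smul_add, smul_smul]
    linear_combination (norm := module) (1 / 4 : ℂ) • hb • (1 : Op ι)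
  · exact .smul (by simp [IsSelfAdjoint])
      ((IsSelfAdjoint.one _).add (.smul (by simp [IsSelfAdjoint]) (hK x).isSelfAdjoint))
  · simp only [sum_units_int, dichotomic, Units.val_one, Int.cast_one, Units.val_neg, Int.cast_neg]
    module

theorem correlator_dichotomic (K : Fin 2 → Op ι) : correlator (dichotomic K) = K := by
  funext x
  simp only [correlator, dichotomic, Units.val_one, Int.cast_one, Units.val_neg, Int.cast_neg]
  module

end Dichotomic

section Coisometry

variable {κ : Type*} {φ φ' : Hil κ}

theorem coisometryOf_apply (f : Hil κ) (i : Fin 2) :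
    (coisometryOf φ φ' f) i = inner ℂ (![φ, φ'] i) f := by
  change inner ℂ φ f * (ket 0 : Hil (Fin 2)) i + inner ℂ φ' f * (ket 1 : Hil (Fin 2)) i = _
  fin_cases i <;> simp [ket_apply]

theorem adjoint_coisometryOf_ket (j : Fin 2) :
    (coisometryOf φ φ').adjoint (ket j) = ![φ, φ'] j :=
  ext_inner_right ℂ fun f => by
    rw [ContinuousLinearMap.adjoint_inner_left, inner_ket, coisometryOf_apply]

theorem coisometryOf_comp_adjoint (h : Orthonormal ℂ ![φ, φ']) :
    coisometryOf φ φ' ∘L (coisometryOf φ φ').adjoint = 1 :=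
  op_ext_entries fun i j => by
    rw [ContinuousLinearMap.comp_apply, coisometryOf_apply, adjoint_coisometryOf_ket,
      orthonormal_iff_ite.1 h, one_apply_eq_self, ket_apply]

end Coisometry

theorem givesComplex_of_intertwining {V : Type} [Fintype V] [DecidableEq V]
    {B : Fin 2 → BellFunctional V} {K : V → Fin 2 → Op (Fin 2)} {φ φ' : Hil (V → Fin 2)}
    {S : Fin 2 → Op (Fin 2)} (hB : ∀ y, BellFunctional.BoundedBy.{u} 1 (B y))
    (hK : ∀ v x, IsReflection (K v x)) (hS : ∀ y, IsReflection (S y))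
    (hφ : Orthonormal ℂ ![φ, φ'])
    (h : ∀ y j, (B y).op K (![φ, φ'] j) = (coisometryOf φ φ').adjoint (S y (ket j))) :
    GivesComplex.{u} B K φ φ' S := by
  have hA : ∀ v, IsMeasurement (dichotomic (K v)) := fun v =>
    (isProjectiveMeasurement_dichotomic (hK v)).isMeasurement
  have hcomp : ∀ y, coisometryOf φ φ' ∘L (B y).op K ∘L (coisometryOf φ φ').adjoint = S y := by
    intro y
    have hint : (B y).op K ∘L (coisometryOf φ φ').adjoint = (coisometryOf φ φ').adjoint ∘L S y :=
      op_ext_ket fun j => (congrArg _ (adjoint_coisometryOf_ket j)).trans (h y j)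
    rw [hint, ← ContinuousLinearMap.comp_assoc, coisometryOf_comp_adjoint hφ]
    rfl
  have hren : (connectorOf B).renormalized (fun v => dichotomic (K v)) (coisometryOf φ φ') =
      dichotomic S := by
    funext b y
    simp only [ConnectorTensor.renormalized, connectorOf_apply B hA, correlator_dichotomic,
      dichotomic, ContinuousLinearMap.smul_comp, ContinuousLinearMap.comp_smul,
      ContinuousLinearMap.add_comp, ContinuousLinearMap.comp_add, hcomp]
    congr 2
    exact coisometryOf_comp_adjoint hφ
  refine ⟨hB, fun ι A hA b y => connectorOf_apply B hA b y,
    ⟨isConnector_connectorOf hB, hA, coisometryOf_comp_adjoint hφ, ?_⟩,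
    fun b y => by rw [hren]; rfl⟩
  rw [hren]
  exact isProjectiveMeasurement_dichotomic hS

/-! ### Qubits -/

section MatrixOperator

variable {n : Type*} [Fintype n] [DecidableEq n]

theorem matOp_apply (M : Matrix n n ℂ) (f : Hil n) (i : n) :
    (matOp M f) i = ∑ k, M i k * f k := rfl

theorem matOp_ket_apply (M : Matrix n n ℂ) (i j : n) : (matOp M (ket j)) i = M i j := by
  simp [matOp_apply, ket_apply]

theorem isReflection_matOp {M : Matrix n n ℂ} (hM : M.IsHermitian) (h : M * M = 1) :
    IsReflection (matOp M) where
  isSelfAdjoint := op_ext_entries fun i j => by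
    rw [ContinuousLinearMap.star_eq_adjoint, adjoint_ket_apply, matOp_ket_apply, matOp_ket_apply]
    exact hM.apply i j
  mul_self := op_ext_entries fun i j => by
    rw [mul_apply_eq_comp, matOp_apply, one_apply_eq_self, ket_apply, ← Matrix.one_apply, ← h,
      Matrix.mul_apply]
    simp only [matOp_ket_apply]

end MatrixOperator

section Pauli

theorem isReflection_σX : IsReflection σX :=
  isReflection_matOp (by ext i j; fin_cases i <;> fin_cases j <;> simp)
    (by simp [Matrix.one_fin_two])

theorem isReflection_σY : IsReflection σY :=
  isReflection_matOp (by ext i j; fin_cases i <;> fin_cases j <;> simp)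
    (by simp [Matrix.one_fin_two])

theorem isReflection_σZ : IsReflection σZ :=
  isReflection_matOp (by ext i j; fin_cases i <;> fin_cases j <;> simp)
    (by simp [Matrix.one_fin_two])

theorem σX_ket (j : Fin 2) : σX (ket j) = ket (j + 1) := by
  ext i
  rw [σX, matOp_ket_apply, ket_apply]
  fin_cases i <;> fin_cases j <;> simp

theorem σY_ket (j : Fin 2) : σY (ket j) = (Complex.I * (-1) ^ (j : ℕ)) • ket (j + 1) := by
  ext i
  change _ = Complex.I * (-1) ^ (j : ℕ) * (ket (j + 1) : Hil (Fin 2)) i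
  rw [σY, matOp_ket_apply, ket_apply]
  fin_cases i <;> fin_cases j <;> simp

theorem σZ_ket (j : Fin 2) : σZ (ket j) = (-1 : ℂ) ^ (j : ℕ) • ket j := by
  ext i
  change _ = (-1) ^ (j : ℕ) * (ket j : Hil (Fin 2)) i
  rw [σZ, matOp_ket_apply, ket_apply]
  fin_cases i <;> fin_cases j <;> simp

theorem σZ_mul_σX_add : σZ * σX + σX * σZ = 0 :=
  op_ext_ket fun j => by
    fin_cases j <;> simp [σX_ket, σZ_ket]

theorem σX_mul_σY_add : σX * σY + σY * σX = 0 :=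
  op_ext_ket fun j => by
    fin_cases j <;> simp [σX_ket, σY_ket]

theorem σZ_mul_σY_add : σZ * σY + σY * σZ = 0 :=
  op_ext_ket fun j => by
    fin_cases j <;> simp [σZ_ket, σY_ket]

end Pauli

/-- The operators `T 0`, `T 1` act on the pair `φ`, `φ'` as `σX`, `σZ` act on `|0⟩`, `|1⟩`. -/
structure ActsAsXZ {κ : Type*} (T : Fin 2 → Op κ) (φ φ' : Hil κ) : Prop where
  one_fst : T 1 φ = φ
  one_snd : T 1 φ' = -φ'
  zero_fst : T 0 φ = φ'
  zero_snd : T 0 φ' = φ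

theorem ActsAsXZ.givesComplex {V : Type} [Fintype V] [DecidableEq V]
    {B : Fin 2 → BellFunctional V} {K : V → Fin 2 → Op (Fin 2)} {φ φ' : Hil (V → Fin 2)}
    (h : ActsAsXZ (fun y => (B y).op K) φ φ') (hB : ∀ y, BellFunctional.BoundedBy.{u} 1 (B y))
    (hK : ∀ v x, IsReflection (K v x)) (hφ : Orthonormal ℂ ![φ, φ']) :
    GivesComplex.{u} B K φ φ' ![σX, σZ] := by
  refine givesComplex_of_intertwining hB hK
    (Fin.forall_fin_two.2 ⟨isReflection_σX, isReflection_σZ⟩) hφ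
    (Fin.forall_fin_two.2 ⟨fun j => ?_, fun j => ?_⟩)
  · fin_cases j <;> simp [σX_ket, adjoint_coisometryOf_ket, h.zero_fst, h.zero_snd]
  · fin_cases j <;> simp [σZ_ket, adjoint_coisometryOf_ket, h.one_fst, h.one_snd]

theorem inner_ket_ket {ι : Type*} [DecidableEq ι] (i j : ι) :
    inner ℂ (ket i) (ket j) = if i = j then (1 : ℂ) else 0 := by
  rw [inner_ket, ket_apply]

theorem orthonormal_pair {κ : Type*} {φ φ' : Hil κ} (h : inner ℂ φ φ = (1 : ℂ))
    (h' : inner ℂ φ' φ' = (1 : ℂ)) (h₀ : inner ℂ φ φ' = (0 : ℂ)) : Orthonormal ℂ ![φ, φ'] := by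
  have h₁ : inner ℂ φ' φ = (0 : ℂ) := inner_eq_zero_symm.1 h₀
  refine orthonormal_iff_ite.2 (Fin.forall_fin_two.2 ⟨Fin.forall_fin_two.2 ⟨?_, ?_⟩,
    Fin.forall_fin_two.2 ⟨?_, ?_⟩⟩)
  exacts [h, h₀, h₁, h']

section TwoQubits

/-- The tensor product `A ⊗ B` of two qubit operators as a bilinear map. -/
noncomputable def tensorTwo : Op (Fin 2) →ₗ[ℂ] Op (Fin 2) →ₗ[ℂ] Op (Fin 2 → Fin 2) :=
  LinearMap.mk₂ ℂ (fun A B => tensorOp (V := Fin 2) (ι := fun _ => Fin 2) ![A, B])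
    (fun A A' B => op_ext_entries fun i j => by
      simp [tensorOp_ket, add_mul])
    (fun c A B => op_ext_entries fun i j => by
      simp [tensorOp_ket, mul_assoc])
    (fun A B B' => op_ext_entries fun i j => by
      simp [tensorOp_ket, mul_add])
    (fun c A B => op_ext_entries fun i j => by
      simp [tensorOp_ket, mul_left_comm])

theorem op_cor (K : Fin 2 → Fin 2 → Op (Fin 2)) (x y : Fin 2) :
    (cor x y).op K = tensorTwo (K 0 x) (K 1 y) := by
  rw [cor, BellFunctional.op_mono, tensorTwo, LinearMap.mk₂_apply]
  congr 1
  funext v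
  fin_cases v <;> rfl

theorem op_corFst (K : Fin 2 → Fin 2 → Op (Fin 2)) (x : Fin 2) :
    (corFst x).op K = tensorTwo (K 0 x) 1 := by
  rw [corFst, BellFunctional.op_mono, tensorTwo, LinearMap.mk₂_apply]
  congr 1
  funext v
  fin_cases v <;> rfl

theorem tensorTwo_ket {A B : Op (Fin 2)} {j j' k k' : Fin 2} {a b : ℂ}
    (hA : A (ket j) = a • ket j') (hB : B (ket k) = b • ket k') :
    tensorTwo A B (ket ![j, k]) = (a * b) • ket ![j', k'] := by
  rw [tensorTwo, LinearMap.mk₂_apply,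
    tensorOp_ket_of_monomial (c := ![a, b]) (x' := ![j', k']) (Fin.forall_fin_two.2 ⟨hA, hB⟩)]
  simp

end TwoQubits

/-! ### Tilted CHSH functionals -/

open scoped ComplexOrder in
theorem BellFunctional.BoundedBy.one_div_smul {V : Type} [Fintype V] [DecidableEq V] {c : ℝ}
    (hc : 0 < c) {B : BellFunctional V} (hB : BellFunctional.BoundedBy.{u} c B) :
    BellFunctional.BoundedBy.{u} 1 ((1 / c) • B) := by
  intro ι A hA
  have hc' : (c : ℂ) ≠ 0 := by exact_mod_cast hc.ne'
  have hinv : (0 : ℂ) ≤ ((1 / c : ℝ) : ℂ) := by exact_mod_cast (one_div_pos.2 hc).le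
  have h := hB ι A hA
  rw [op_smul]
  constructor
  · convert h.1.smul_of_nonneg hinv using 1
    rw [smul_sub, smul_smul]
    simp [hc']
  · convert h.2.smul_of_nonneg hinv using 1
    rw [smul_add, smul_smul]
    simp [hc']

/-- `1 ⊗ K^{(2)}_y`. -/
noncomputable def corSnd (y : Fin 2) : BellFunctional (Fin 2) := mono ![none, some y]

section TwoParties

variable {ι : Fin 2 → Type*} {K : ∀ v, Fin 2 → Op (ι v)}

theorem op_cor_eq_mul (K : ∀ v, Fin 2 → Op (ι v)) (x y : Fin 2) :
    (cor x y).op K = (corFst x).op K * (corSnd y).op K := by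
  rw [corFst, corSnd, BellFunctional.op_mono_mul K (by simp [Fin.forall_fin_two]), cor]
  congr 2
  funext v
  fin_cases v <;> rfl

theorem commutingObservables_corFst_corSnd (hK : ∀ v x, AbsLE 1 (K v x)) :
    CommutingObservables (fun x => (corFst x).op K) (fun y => (corSnd y).op K) where
  left x := BellFunctional.absLE_op_mono hK ![some x, none]
  right y := BellFunctional.absLE_op_mono hK ![none, some y]
  commute _ _ := BellFunctional.commute_op_mono K (by simp [Fin.forall_fin_two])

end TwoParties

theorem boundedBy_tiltedCHSH (α : ℝ) : BellFunctional.BoundedBy.{u} √(8 + 2 * α ^ 2)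
    (α • corFst 0 + cor 0 0 + cor 1 0 + cor 0 1 - cor 1 1) :=
  .of_absLE fun ι K hK => by
    convert absLE_tiltedCHSH α (commutingObservables_corFst_corSnd hK) using 1
    simp only [BellFunctional.op_add, BellFunctional.op_sub, BellFunctional.op_smul,
      op_cor_eq_mul, tiltedCHSH]

/-- The functional `B₀` is `B₁` after the substitution `a₀ ↦ a₁`, `a₁ ↦ -a₀`. -/
theorem boundedBy_tiltedCHSH_swap (α : ℝ) : BellFunctional.BoundedBy.{u} √(8 + 2 * α ^ 2)
    (α • corFst 1 - cor 0 0 + cor 1 0 + cor 0 1 + cor 1 1) :=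
  .of_absLE fun ι K hK => by
    have h := commutingObservables_corFst_corSnd hK
    have h' : CommutingObservables ![(corFst 1).op K, -(corFst 0).op K]
        (fun y => (corSnd y).op K) :=
      ⟨Fin.forall_fin_two.2 ⟨h.left 1, (h.left 0).neg⟩, h.right,
        Fin.forall_fin_two.2 ⟨h.commute 1, fun y => (h.commute 0 y).neg_left⟩⟩
    convert absLE_tiltedCHSH α h' using 1
    simp only [BellFunctional.op_add, BellFunctional.op_sub, BellFunctional.op_smul,
      op_cor_eq_mul, tiltedCHSH, Matrix.cons_val_zero, Matrix.cons_val_one, neg_mul]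
    abel

namespace Tilted

variable (θ : ℝ)

theorem α_eq : α θ = 2 * Real.cos (2 * θ) / √(1 + Real.sin (2 * θ) ^ 2) := by
  rw [α]
  set c := Real.cos (2 * θ) with hc
  set r := √(1 + Real.sin (2 * θ) ^ 2) with hr
  have hr₀ : 0 < r := Real.sqrt_pos.2 (by positivity)
  rcases eq_or_ne c 0 with h₀ | h₀
  · simp [h₀]
  have hsqrt : √(1 + 2 * Real.tan (2 * θ) ^ 2) = r / |c| := by
    rw [← abs_of_pos hr₀, ← abs_div, ← Real.sqrt_sq_eq_abs, div_pow, hr,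
      Real.sq_sqrt (by positivity), Real.tan_eq_sin_div_cos, ← hc]
    congr 1
    field_simp
    linear_combination Real.sin_sq_add_cos_sq (2 * θ)
  have hsign : c.sign * |c| = c := by
    rcases h₀.lt_or_gt with h | h
    · rw [Real.sign_of_neg h, abs_of_neg h, neg_one_mul, neg_neg]
    · rw [Real.sign_of_pos h, abs_of_pos h, one_mul]
  rw [hsqrt, div_div_eq_mul_div, mul_assoc, hsign]

theorem β_eq : β θ = 4 / √(1 + Real.sin (2 * θ) ^ 2) := by
  have hr : √(1 + Real.sin (2 * θ) ^ 2) ^ 2 = 1 + Real.sin (2 * θ) ^ 2 :=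
    Real.sq_sqrt (by positivity)
  rw [β, Real.sqrt_eq_iff_eq_sq (by positivity) (by positivity), α_eq, div_pow, div_pow, hr]
  field_simp
  linear_combination 8 * Real.sin_sq_add_cos_sq (2 * θ)

theorem β_pos : 0 < β θ := by
  rw [β_eq]
  positivity

theorem cos_μ : Real.cos (μ θ) = β θ / 4 := by
  rw [μ, Real.cos_arctan, β_eq]
  ring

theorem sin_μ : Real.sin (μ θ) = Real.sin (2 * θ) * β θ / 4 := by
  rw [μ, Real.sin_arctan, β_eq]
  ring

theorem α_eq_cos_mul_β : α θ = Real.cos (2 * θ) * β θ / 2 := by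
  rw [α_eq, β_eq]
  ring

theorem isReflection_K (v x : Fin 2) : IsReflection (K θ v x) := by
  have h := isReflection_σZ.smul_add_smul isReflection_σX σZ_mul_σX_add
    (Real.cos_sq_add_sin_sq (μ θ))
  have h' := isReflection_σZ.smul_add_smul isReflection_σX σZ_mul_σX_add
    (r := Real.cos (μ θ)) (s := -Real.sin (μ θ)) (by rw [neg_sq, Real.cos_sq_add_sin_sq])
  rw [Complex.ofReal_neg, neg_smul, ← sub_eq_add_neg] at h'
  fin_cases v <;> fin_cases x
  exacts [isReflection_σZ, isReflection_σX, h, h']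

theorem op_B_one : (B θ 1).op (K θ) = (1 / 2 : ℂ) •
    ((Real.cos (2 * θ) : ℂ) • tensorTwo σZ 1 + tensorTwo σZ σZ +
      (Real.sin (2 * θ) : ℂ) • tensorTwo σX σX) := by
  have hβ : (β θ : ℂ) ≠ 0 := by exact_mod_cast (β_pos θ).ne'
  have h : (B θ 1).op (K θ) = _ := BellFunctional.op_smul (K θ) _ _
  rw [h]
  simp only [BellFunctional.op_add, BellFunctional.op_sub, BellFunctional.op_smul, op_cor,
    op_corFst, K, Matrix.cons_val_zero, Matrix.cons_val_one, map_add, map_sub, map_smul,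
    α_eq_cos_mul_β, cos_μ, sin_μ]
  push_cast
  match_scalars <;> field_simp <;> ring

theorem op_B_zero : (B θ 0).op (K θ) = (1 / 2 : ℂ) •
    ((Real.cos (2 * θ) : ℂ) • tensorTwo σX 1 + tensorTwo σX σZ -
      (Real.sin (2 * θ) : ℂ) • tensorTwo σZ σX) := by
  have hβ : (β θ : ℂ) ≠ 0 := by exact_mod_cast (β_pos θ).ne'
  have h : (B θ 0).op (K θ) = _ := BellFunctional.op_smul (K θ) _ _
  rw [h]
  simp only [BellFunctional.op_add, BellFunctional.op_sub, BellFunctional.op_smul, op_cor,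
    op_corFst, K, Matrix.cons_val_zero, Matrix.cons_val_one, map_add, map_sub, map_smul,
    α_eq_cos_mul_β, cos_μ, sin_μ]
  push_cast
  match_scalars <;> field_simp <;> ring

end Tilted

section TwoQubitPauli

variable (j k : Fin 2)

theorem tensorTwo_σZ_one_ket : tensorTwo σZ 1 (ket ![j, k]) = (-1 : ℂ) ^ (j : ℕ) • ket ![j, k] := by
  simpa using tensorTwo_ket (B := 1) (σZ_ket j) (one_smul ℂ _).symm

theorem tensorTwo_σX_one_ket : tensorTwo σX 1 (ket ![j, k]) = ket ![j + 1, k] := by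
  simpa using tensorTwo_ket (B := 1) ((σX_ket j).trans (one_smul ℂ _).symm) (one_smul ℂ _).symm

theorem tensorTwo_σZ_σZ_ket :
    tensorTwo σZ σZ (ket ![j, k]) = ((-1) ^ (j : ℕ) * (-1 : ℂ) ^ (k : ℕ)) • ket ![j, k] :=
  tensorTwo_ket (σZ_ket j) (σZ_ket k)

theorem tensorTwo_σX_σX_ket : tensorTwo σX σX (ket ![j, k]) = ket ![j + 1, k + 1] := by
  simpa using tensorTwo_ket ((σX_ket j).trans (one_smul ℂ _).symm)
    ((σX_ket k).trans (one_smul ℂ _).symm)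

theorem tensorTwo_σX_σZ_ket :
    tensorTwo σX σZ (ket ![j, k]) = (-1 : ℂ) ^ (k : ℕ) • ket ![j + 1, k] := by
  simpa using tensorTwo_ket ((σX_ket j).trans (one_smul ℂ _).symm) (σZ_ket k)

theorem tensorTwo_σZ_σX_ket :
    tensorTwo σZ σX (ket ![j, k]) = (-1 : ℂ) ^ (j : ℕ) • ket ![j, k + 1] := by
  simpa using tensorTwo_ket (σZ_ket j) ((σX_ket k).trans (one_smul ℂ _).symm)

end TwoQubitPauli

namespace Tilted

variable (θ : ℝ)

theorem actsAsXZ : ActsAsXZ (fun y => (B θ y).op (K θ)) (φp θ) (φm θ) := by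
  have hcos : (Real.cos (2 * θ) : ℂ) * Real.cos θ + Real.sin (2 * θ) * Real.sin θ =
      Real.cos θ := by
    exact_mod_cast (Real.cos_sub (2 * θ) θ).symm.trans (by ring_nf)
  have hsin : (Real.sin (2 * θ) : ℂ) * Real.cos θ - Real.cos (2 * θ) * Real.sin θ =
      Real.sin θ := by
    exact_mod_cast (Real.sin_sub (2 * θ) θ).symm.trans (by ring_nf)
  have htwo : (1 + 1 : Fin 2) = 0 := rfl
  constructor <;>
  simp only [op_B_one, op_B_zero, φp, φm] <;>
  generalize (Real.cos θ : ℂ) = c at * <;>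
  generalize (Real.sin θ : ℂ) = s at * <;>
  generalize (Real.cos (2 * θ) : ℂ) = c₂ at * <;>
  generalize (Real.sin (2 * θ) : ℂ) = s₂ at * <;>
  simp only [map_add, map_sub, map_smul, add_apply, sub_apply,
    smul_apply, tensorTwo_σZ_one_ket, tensorTwo_σX_one_ket, tensorTwo_σZ_σZ_ket,
    tensorTwo_σX_σX_ket, tensorTwo_σX_σZ_ket, tensorTwo_σZ_σX_ket, htwo, zero_add, Fin.val_zero,
    Fin.val_one, pow_zero, pow_one] <;>
  match_scalars <;>
  first
  | linear_combination (1 / 2 : ℂ) * hcos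
  | linear_combination (-1 / 2 : ℂ) * hcos
  | linear_combination (1 / 2 : ℂ) * hsin
  | linear_combination (-1 / 2 : ℂ) * hsin

theorem orthonormal : Orthonormal ℂ ![φp θ, φm θ] := by
  have hsc : (Real.sin θ : ℂ) ^ 2 + (Real.cos θ : ℂ) ^ 2 = 1 := by
    exact_mod_cast Real.sin_sq_add_cos_sq θ
  refine orthonormal_pair ?_ ?_ ?_ <;>
  simp only [φp, φm, inner_add_left, inner_add_right, inner_sub_left, inner_sub_right,
    inner_smul_left, inner_smul_right, inner_ket_ket, Complex.conj_ofReal, ↓reduceIte,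
    Matrix.vecCons_inj, zero_ne_one, one_ne_zero, and_true, and_self, and_false]
  · linear_combination hsc
  · linear_combination hsc
  · ring

theorem boundedBy_B : ∀ y, BellFunctional.BoundedBy.{u} 1 (B θ y) :=
  Fin.forall_fin_two.2 ⟨(boundedBy_tiltedCHSH_swap (α θ)).one_div_smul (β_pos θ),
    (boundedBy_tiltedCHSH (α θ)).one_div_smul (β_pos θ)⟩

theorem givesComplex : GivesComplex.{u} (B θ) (K θ) (φp θ) (φm θ) ![σX, σZ] :=
  (actsAsXZ θ).givesComplex (boundedBy_B θ) (isReflection_K θ) (orthonormal θ)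

end Tilted

namespace CHSH

theorem β_tilted : Tilted.β (Real.pi / 4) = 2 * √2 := by
  rw [Tilted.β_eq, show 2 * (Real.pi / 4) = Real.pi / 2 by ring, Real.sin_pi_div_two, one_pow,
    one_add_one_eq_two, div_eq_iff (by positivity), mul_assoc, Real.mul_self_sqrt zero_le_two]
  norm_num

theorem α_tilted : Tilted.α (Real.pi / 4) = 0 := by
  rw [Tilted.α_eq, show 2 * (Real.pi / 4) = Real.pi / 2 by ring, Real.cos_pi_div_two, mul_zero,
    zero_div]

theorem B_eq_tilted : B = Tilted.B (Real.pi / 4) := by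
  rw [B, Tilted.B, α_tilted, β_tilted, zero_smul, zero_smul, zero_sub, zero_add]

theorem K_eq_tilted : K = Tilted.K (Real.pi / 4) := by
  have hcos : Real.cos (Tilted.μ (Real.pi / 4)) = 1 / √2 := by
    rw [Tilted.cos_μ, β_tilted, ← Real.sqrt_div_self']
    ring
  have hsin : Real.sin (Tilted.μ (Real.pi / 4)) = 1 / √2 := by
    rw [Tilted.sin_μ, ← hcos, Tilted.cos_μ, show 2 * (Real.pi / 4) = Real.pi / 2 by ring,
      Real.sin_pi_div_two, one_mul]
  rw [K, Tilted.K, hcos, hsin, smul_add, smul_sub]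

theorem φp_eq_tilted : φp = Tilted.φp (Real.pi / 4) := by
  rw [φp, Tilted.φp, Real.cos_pi_div_four, Real.sin_pi_div_four, Real.sqrt_div_self', smul_add]

theorem φm_eq_tilted : φm = Tilted.φm (Real.pi / 4) := by
  rw [φm, Tilted.φm, Real.cos_pi_div_four, Real.sin_pi_div_four, Real.sqrt_div_self', smul_sub]

theorem actsAsXZ : ActsAsXZ (fun y => (B y).op K) φp φm := by
  rw [B_eq_tilted, K_eq_tilted, φp_eq_tilted, φm_eq_tilted]
  exact Tilted.actsAsXZ _

theorem givesComplex : GivesComplex.{u} B K φp φm ![σX, σZ] := by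
  rw [B_eq_tilted, K_eq_tilted, φp_eq_tilted, φm_eq_tilted]
  exact Tilted.givesComplex _

end CHSH

/-! ### The WBC functionals -/

/-- The functional `∑ x y, w x y K^{(1)}_x ⊗ K^{(2)}_y` without marginal terms. -/
noncomputable def correlationSum (w : Fin 2 → Fin 2 → ℝ) : BellFunctional (Fin 2) :=
  ∑ x, ∑ y, w x y • cor x y

theorem op_correlationSum {ι : Fin 2 → Type*} (K : ∀ v, Fin 2 → Op (ι v))
    (w : Fin 2 → Fin 2 → ℝ) :
    (correlationSum w).op K = ∑ x, ∑ y, (w x y : ℂ) • (cor x y).op K := by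
  simp only [correlationSum, BellFunctional.op_sum, BellFunctional.op_smul]

theorem boundedBy_correlationSum {l : Fin 2 → ℝ} {p : Fin 2 → Fin 2 → ℝ} (hl : ∀ x, 0 ≤ l x)
    (horth : ∀ y y', y ≠ y' → ∑ x, l x * p x y * p x y' = 0) :
    BellFunctional.BoundedBy.{u} ((∑ x, l x + ∑ y, ∑ x, l x * p x y ^ 2) / 2)
      (correlationSum fun x y => l x * p x y) :=
  .of_absLE fun ι K hK => by
    simpa only [op_correlationSum, op_cor_eq_mul] using
      absLE_sum_smul_mul hl horth (commutingObservables_corFst_corSnd hK)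

namespace WBC

section SwapSettings

variable {V : Type} [Fintype V] [DecidableEq V]

theorem op_swapSettings (B : BellFunctional V) {ι : V → Type*} (K : ∀ v, Fin 2 → Op (ι v)) :
    (swapSettings B).op K = B.op fun v x => K v (Equiv.swap 0 1 x) := by
  rw [BellFunctional.op, BellFunctional.op,
    ← (Equiv.piCongrRight fun _ : V => (Equiv.swap (0 : Fin 2) 1).optionCongr).sum_comp]
  refine Finset.sum_congr rfl fun s _ => ?_
  simp only [swapSettings, Equiv.piCongrRight_apply, Pi.map_apply, Equiv.optionCongr_apply,
    Option.map_map, Function.comp_def, Equiv.swap_apply_self, Option.map_id']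
  congr 2
  funext v
  cases s v <;> rfl

theorem boundedBy_swapSettings {c : ℝ} {B : BellFunctional V}
    (hB : BellFunctional.BoundedBy.{u} c B) : BellFunctional.BoundedBy.{u} c (swapSettings B) := by
  intro ι A hA
  rw [op_swapSettings]
  exact hB ι (fun v a x => A v a (Equiv.swap 0 1 x))
    fun v => ⟨fun a x => (hA v).1 a _, fun x => (hA v).2 _⟩

end SwapSettings

section Trigonometry

variable (θ φ ω : ℝ)

theorem cos_mul_cos_sub_cos_add_mul_cos_add :
    Real.cos φ * Real.cos ω - Real.cos (θ + φ) * Real.cos (θ + ω) =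
      Real.sin θ * Real.sin (θ + φ + ω) := by
  rw [Real.sin_add (θ + φ), Real.sin_add θ φ, Real.cos_add θ φ, Real.cos_add θ ω]
  linear_combination (-Real.cos φ * Real.cos ω) * Real.sin_sq_add_cos_sq θ

theorem cos_add_mul_cos_sub_cos_mul_cos_add :
    Real.cos (θ + φ) * Real.cos ω - Real.cos φ * Real.cos (θ + ω) =
      Real.sin θ * Real.sin (ω - φ) := by
  rw [Real.sin_sub, Real.cos_add, Real.cos_add]
  ring

theorem cos_add_mul_cos_sub_cos_add_mul_cos :
    Real.cos (θ + φ) * Real.cos φ - Real.cos (θ + ω) * Real.cos ω =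
      Real.sin (ω - φ) * Real.sin (θ + φ + ω) := by
  rw [Real.sin_sub, Real.sin_add (θ + φ), Real.sin_add θ φ, Real.cos_add θ φ, Real.cos_add θ ω]
  linear_combination
    (Real.cos θ * Real.cos ω ^ 2 - Real.sin θ * Real.cos ω * Real.sin ω) *
      Real.sin_sq_add_cos_sq φ +
    (Real.cos φ * Real.sin θ * Real.sin φ - Real.cos θ * Real.cos φ ^ 2) *
      Real.sin_sq_add_cos_sq ω

end Trigonometry

section Bound

variable (θ φ ω : ℝ)

/-- The coefficients of the functional `B₁`. -/
noncomputable def weight : Fin 2 → Fin 2 → ℝ := fun x y =>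
  ![![Real.cos (θ + φ) * Real.cos (θ + ω) * Real.cos ω,
      -(Real.cos (θ + φ) * Real.cos (θ + ω) * Real.cos φ)],
    ![-(Real.cos φ * Real.cos ω * Real.cos (θ + ω)),
      Real.cos φ * Real.cos ω * Real.cos (θ + φ)]] x y / β θ φ ω

/-- The weights `l x` in the decomposition `weight x y = l x * p x y` which makes
`1 - B₁` a sum of squares `∑ x, l x (a x - ∑ y, p x y b y)² / 2`. -/
noncomputable def rowWeight : Fin 2 → ℝ := fun x =>
  ![-(Real.cos (θ + φ) * Real.cos (θ + ω)), Real.cos φ * Real.cos ω] x *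
    Real.sin (ω - φ) / β θ φ ω

/-- The vectors `p x` in the decomposition `weight x y = l x * p x y`: at the optimal observables,
`a x` equals `∑ y, p x y b y`. -/
noncomputable def optimalDirection : Fin 2 → Fin 2 → ℝ := fun x y =>
  ![![-Real.cos ω, Real.cos φ], ![-Real.cos (θ + ω), Real.cos (θ + φ)]] x y / Real.sin (ω - φ)

theorem B₁_eq_correlationSum : B₁ θ φ ω = correlationSum (weight θ φ ω) := by
  simp only [B₁, correlationSum, weight, Fin.sum_univ_two, Matrix.cons_val_zero,
    Matrix.cons_val_one]
  module

variable {θ φ ω}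

theorem β_ne_zero (h : Real.cos (θ + φ) * Real.cos φ * Real.cos (θ + ω) * Real.cos ω < 0) :
    β θ φ ω ≠ 0 := by
  have hfst := cos_mul_cos_sub_cos_add_mul_cos_add θ φ ω
  have hcross := cos_add_mul_cos_sub_cos_mul_cos_add θ φ ω
  contrapose! h
  rw [β, mul_eq_zero] at h
  rcases h with h | h
  · rw [h] at hcross
    linear_combination sq_nonneg (Real.cos (θ + φ) * Real.cos ω) +
      Real.cos (θ + φ) * Real.cos ω * hcross
  · rw [h, mul_zero] at hfst
    linear_combination sq_nonneg (Real.cos φ * Real.cos ω) + Real.cos φ * Real.cos ω * hfst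

theorem sin_sub_ne_zero (hβ : β θ φ ω ≠ 0) : Real.sin (ω - φ) ≠ 0 :=
  (mul_ne_zero_iff.1 (mul_ne_zero_iff.1 hβ).1).2

theorem rowWeight_mul_optimalDirection (hβ : β θ φ ω ≠ 0) :
    (fun x y => rowWeight θ φ ω x * optimalDirection θ φ ω x y) = weight θ φ ω := by
  have hS := sin_sub_ne_zero hβ
  funext x y
  fin_cases x <;> fin_cases y <;> simp [rowWeight, optimalDirection, weight] <;> field_simp

theorem sum_rowWeight (hβ : β θ φ ω ≠ 0) : ∑ x, rowWeight θ φ ω x = 1 := by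
  have h := cos_mul_cos_sub_cos_add_mul_cos_add θ φ ω
  rw [Fin.sum_univ_two, rowWeight, rowWeight, ← add_div, div_eq_one_iff_eq hβ, β]
  simp only [Matrix.cons_val_zero, Matrix.cons_val_one]
  linear_combination Real.sin (ω - φ) * h

theorem rowWeight_nonneg
    (h : Real.cos (θ + φ) * Real.cos φ * Real.cos (θ + ω) * Real.cos ω < 0) (x : Fin 2) :
    0 ≤ rowWeight θ φ ω x := by
  have hsum := sum_rowWeight (β_ne_zero h)
  have hprod : 0 ≤ rowWeight θ φ ω 0 * rowWeight θ φ ω 1 := by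
    have heq : rowWeight θ φ ω 0 * rowWeight θ φ ω 1 =
        -(Real.cos (θ + φ) * Real.cos φ * Real.cos (θ + ω) * Real.cos ω) *
          (Real.sin (ω - φ) / β θ φ ω) ^ 2 := by
      simp only [rowWeight, Matrix.cons_val_zero, Matrix.cons_val_one]
      ring
    rw [heq]
    exact mul_nonneg (neg_nonneg.2 h.le) (sq_nonneg _)
  rw [Fin.sum_univ_two] at hsum
  fin_cases x
  · change 0 ≤ rowWeight θ φ ω 0
    nlinarith
  · change 0 ≤ rowWeight θ φ ω 1
    nlinarith

theorem sum_rowWeight_mul_mul {y y' : Fin 2} (hy : y ≠ y') :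
    ∑ x, rowWeight θ φ ω x * optimalDirection θ φ ω x y * optimalDirection θ φ ω x y' = 0 := by
  fin_cases y <;> fin_cases y' <;> first | exact absurd rfl hy | skip
  all_goals
    simp [rowWeight, optimalDirection]
    ring

theorem sum_rowWeight_mul_sq (hβ : β θ φ ω ≠ 0) :
    ∑ y, ∑ x, rowWeight θ φ ω x * optimalDirection θ φ ω x y ^ 2 = 1 := by
  have hS := sin_sub_ne_zero hβ
  have hcross := cos_add_mul_cos_sub_cos_mul_cos_add θ φ ω
  have hsnd := cos_add_mul_cos_sub_cos_add_mul_cos θ φ ω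
  have hβ' : β θ φ ω = Real.sin θ * Real.sin (ω - φ) * Real.sin (θ + φ + ω) := rfl
  simp only [rowWeight, optimalDirection, Fin.sum_univ_two, Matrix.cons_val_zero,
    Matrix.cons_val_one]
  field_simp
  linear_combination
    (Real.cos (θ + φ) * Real.cos φ - Real.cos (θ + ω) * Real.cos ω) * hcross +
      Real.sin θ * Real.sin (ω - φ) * hsnd - Real.sin (ω - φ) * hβ'

theorem boundedBy_B₁ (h : Real.cos (θ + φ) * Real.cos φ * Real.cos (θ + ω) * Real.cos ω < 0) :
    BellFunctional.BoundedBy.{u} 1 (B₁ θ φ ω) := by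
  have hβ := β_ne_zero h
  have hbound := boundedBy_correlationSum.{u} (rowWeight_nonneg h)
    fun _ _ => sum_rowWeight_mul_mul
  rwa [sum_rowWeight hβ, sum_rowWeight_mul_sq hβ, add_self_div_two,
    rowWeight_mul_optimalDirection hβ, ← B₁_eq_correlationSum] at hbound

theorem boundedBy_B (h : Real.cos (θ + φ) * Real.cos φ * Real.cos (θ + ω) * Real.cos ω < 0) :
    ∀ y, BellFunctional.BoundedBy.{u} 1 (B θ φ ω y) :=
  Fin.forall_fin_two.2 ⟨boundedBy_swapSettings (B := B₁ θ φ ω) (boundedBy_B₁ h), boundedBy_B₁ h⟩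

end Bound

end WBC

namespace WBC

theorem equatorial_zero : equatorial 0 = σX := by
  simp [equatorial]

theorem isReflection_equatorial (t : ℝ) : IsReflection (equatorial t) :=
  isReflection_σX.smul_add_smul isReflection_σY σX_mul_σY_add (Real.cos_sq_add_sin_sq t)

theorem isReflection_K (θ φ ω : ℝ) (v x : Fin 2) : IsReflection (K θ φ ω v x) := by
  fin_cases v <;> fin_cases x
  exacts [isReflection_σX, isReflection_equatorial θ, isReflection_equatorial φ,
    isReflection_equatorial ω]

theorem equatorial_ket_zero (t : ℝ) :
    equatorial t (ket 0) = (Real.cos t + Complex.I * Real.sin t : ℂ) • ket 1 := by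
  simp only [equatorial, add_apply, smul_apply, σX_ket, σY_ket, zero_add, Fin.val_zero, pow_zero]
  module

theorem equatorial_ket_one (t : ℝ) :
    equatorial t (ket 1) = (Real.cos t - Complex.I * Real.sin t : ℂ) • ket 0 := by
  simp only [equatorial, add_apply, smul_apply, σX_ket, σY_ket, Fin.val_one, pow_one,
    show (1 + 1 : Fin 2) = 0 from rfl]
  module

section PhaseRotation

variable (s t : ℝ)

theorem tensorTwo_equatorial_ket_zero : tensorTwo (equatorial s) (equatorial t) (ket ![0, 0]) =
    (Real.cos (s + t) + Complex.I * Real.sin (s + t) : ℂ) • ket ![1, 1] := by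
  rw [tensorTwo_ket (equatorial_ket_zero s) (equatorial_ket_zero t), Real.cos_add, Real.sin_add]
  push_cast
  congr 1
  linear_combination Complex.sin s * Complex.sin t * Complex.I_mul_I

theorem tensorTwo_equatorial_ket_one : tensorTwo (equatorial s) (equatorial t) (ket ![1, 1]) =
    (Real.cos (s + t) - Complex.I * Real.sin (s + t) : ℂ) • ket ![0, 0] := by
  rw [tensorTwo_ket (equatorial_ket_one s) (equatorial_ket_one t), Real.cos_add, Real.sin_add]
  push_cast
  congr 1
  linear_combination Complex.sin s * Complex.sin t * Complex.I_mul_I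

theorem tensorTwo_equatorial_φp : tensorTwo (equatorial s) (equatorial t) φp =
    (Real.sin (s + t) : ℂ) • φp + (Complex.I * Real.cos (s + t)) • φm := by
  rw [φp, φm, map_smul, map_add, map_smul, tensorTwo_equatorial_ket_zero,
    tensorTwo_equatorial_ket_one]
  generalize (Real.cos (s + t) : ℂ) = c, (Real.sin (s + t) : ℂ) = d, ((1 / √2 : ℝ) : ℂ) = r
  match_scalars
  · linear_combination r * c * Complex.I_mul_I
  · linear_combination -(r * d) * Complex.I_mul_I

theorem tensorTwo_equatorial_φm : tensorTwo (equatorial s) (equatorial t) φm =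
    -(Real.sin (s + t) : ℂ) • φm - (Complex.I * Real.cos (s + t)) • φp := by
  rw [φp, φm, map_smul, map_sub, map_smul, tensorTwo_equatorial_ket_zero,
    tensorTwo_equatorial_ket_one]
  generalize (Real.cos (s + t) : ℂ) = c, (Real.sin (s + t) : ℂ) = d, ((1 / √2 : ℝ) : ℂ) = r
  match_scalars
  · linear_combination r * c * Complex.I_mul_I
  · linear_combination r * d * Complex.I_mul_I

end PhaseRotation

section CorrelationSum

variable {K : Fin 2 → Fin 2 → Op (Fin 2)} {s t : Fin 2 → ℝ} {w : Fin 2 → Fin 2 → ℝ} {a b : ℝ}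
  (hs : ∀ x, K 0 x = equatorial (s x)) (ht : ∀ y, K 1 y = equatorial (t y))
  (ha : ∑ x, ∑ y, w x y * Real.sin (s x + t y) = a)
  (hb : ∑ x, ∑ y, w x y * Real.cos (s x + t y) = b)

include hs ht ha hb

theorem op_correlationSum_φp :
    (correlationSum w).op K φp = (a : ℂ) • φp + (Complex.I * b) • φm := by
  simp only [op_correlationSum, op_cor, hs, ht, sum_apply, smul_apply, tensorTwo_equatorial_φp,
    ← ha, ← hb, Complex.ofReal_sum, Complex.ofReal_mul, Finset.mul_sum, Finset.sum_smul, smul_add,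
    Finset.sum_add_distrib, smul_smul, mul_left_comm Complex.I]

theorem op_correlationSum_φm :
    (correlationSum w).op K φm = -(a : ℂ) • φm - (Complex.I * b) • φp := by
  simp only [op_correlationSum, op_cor, hs, ht, sum_apply, smul_apply, tensorTwo_equatorial_φm,
    ← ha, ← hb, Complex.ofReal_sum, Complex.ofReal_mul, Finset.mul_sum, Finset.sum_smul, smul_sub,
    Finset.sum_sub_distrib, smul_smul, mul_left_comm Complex.I, neg_smul, smul_neg,
    Finset.sum_neg_distrib]

end CorrelationSum

section Eigenvectors

variable {θ φ ω : ℝ}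

theorem sum_weight_mul_cos :
    ∑ x, ∑ y, weight θ φ ω x y * Real.cos (![0, θ] x + ![φ, ω] y) = 0 := by
  simp only [weight, Fin.sum_univ_two, Matrix.cons_val_zero, Matrix.cons_val_one, zero_add]
  ring

theorem sum_weight_mul_sin (hβ : β θ φ ω ≠ 0) :
    ∑ x, ∑ y, weight θ φ ω x y * Real.sin (![0, θ] x + ![φ, ω] y) = 1 := by
  have hfst := cos_mul_cos_sub_cos_add_mul_cos_add θ φ ω
  have hsub : Real.sin (θ + ω) * Real.cos (θ + φ) - Real.cos (θ + ω) * Real.sin (θ + φ) =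
      Real.sin (ω - φ) := by
    rw [← Real.sin_sub, add_sub_add_left_eq_sub]
  have hβ' : β θ φ ω = Real.sin θ * Real.sin (ω - φ) * Real.sin (θ + φ + ω) := rfl
  simp only [weight, Fin.sum_univ_two, Matrix.cons_val_zero, Matrix.cons_val_one, zero_add]
  field_simp
  linear_combination Real.cos φ * Real.cos ω * hsub + Real.sin (ω - φ) * hfst - hβ' +
    Real.cos (θ + φ) * Real.cos (θ + ω) * Real.sin_sub ω φ

theorem swapped_angle (x y : Fin 2) :
    ![θ, 0] x + ![ω, φ] y = (θ + φ + ω) - (![0, θ] x + ![φ, ω] y) := by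
  fin_cases x <;> fin_cases y <;> (dsimp; ring)

theorem sum_weight_mul_sin_swapped (hβ : β θ φ ω ≠ 0) :
    ∑ x, ∑ y, weight θ φ ω x y * Real.sin (![θ, 0] x + ![ω, φ] y) = -Real.cos (θ + φ + ω) := by
  have hcos := sum_weight_mul_cos (θ := θ) (φ := φ) (ω := ω)
  have hsin := sum_weight_mul_sin hβ
  simp only [swapped_angle, Real.sin_sub (θ + φ + ω), Fin.sum_univ_two] at *
  linear_combination Real.sin (θ + φ + ω) * hcos - Real.cos (θ + φ + ω) * hsin

theorem sum_weight_mul_cos_swapped (hβ : β θ φ ω ≠ 0) :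
    ∑ x, ∑ y, weight θ φ ω x y * Real.cos (![θ, 0] x + ![ω, φ] y) = Real.sin (θ + φ + ω) := by
  have hcos := sum_weight_mul_cos (θ := θ) (φ := φ) (ω := ω)
  have hsin := sum_weight_mul_sin hβ
  simp only [swapped_angle, Real.cos_sub (θ + φ + ω), Fin.sum_univ_two] at *
  linear_combination Real.cos (θ + φ + ω) * hcos + Real.sin (θ + φ + ω) * hsin

theorem K_zero_eq_equatorial (x : Fin 2) : K θ φ ω 0 x = equatorial (![0, θ] x) := by
  fin_cases x
  exacts [equatorial_zero.symm, rfl]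

theorem K_one_eq_equatorial (y : Fin 2) : K θ φ ω 1 y = equatorial (![φ, ω] y) := by
  fin_cases y <;> rfl

theorem K_zero_swap (x : Fin 2) :
    K θ φ ω 0 (Equiv.swap 0 1 x) = equatorial (![θ, 0] x) := by
  rw [K_zero_eq_equatorial]
  fin_cases x <;> rfl

theorem K_one_swap (y : Fin 2) :
    K θ φ ω 1 (Equiv.swap 0 1 y) = equatorial (![ω, φ] y) := by
  fin_cases y <;> rfl

variable (hβ : β θ φ ω ≠ 0)

include hβ

theorem op_B_one_φp : (B θ φ ω 1).op (K θ φ ω) φp = φp := by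
  refine (congrArg (fun b => BellFunctional.op b (K θ φ ω) φp)
    (B₁_eq_correlationSum θ φ ω)).trans ?_
  simpa using op_correlationSum_φp K_zero_eq_equatorial K_one_eq_equatorial
    (sum_weight_mul_sin hβ) sum_weight_mul_cos

theorem op_B_one_φm : (B θ φ ω 1).op (K θ φ ω) φm = -φm := by
  refine (congrArg (fun b => BellFunctional.op b (K θ φ ω) φm)
    (B₁_eq_correlationSum θ φ ω)).trans ?_
  simpa using op_correlationSum_φm K_zero_eq_equatorial K_one_eq_equatorial
    (sum_weight_mul_sin hβ) sum_weight_mul_cos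

theorem op_B_zero_φp : (B θ φ ω 0).op (K θ φ ω) φp =
    -(Real.cos (θ + φ + ω) : ℂ) • φp + (Complex.I * (Real.sin (θ + φ + ω) : ℂ)) • φm := by
  rw [← Complex.ofReal_neg, show B θ φ ω 0 = swapSettings (B₁ θ φ ω) from rfl, op_swapSettings,
    B₁_eq_correlationSum]
  exact op_correlationSum_φp K_zero_swap K_one_swap (sum_weight_mul_sin_swapped hβ)
    (sum_weight_mul_cos_swapped hβ)

theorem op_B_zero_φm : (B θ φ ω 0).op (K θ φ ω) φm =
    (Real.cos (θ + φ + ω) : ℂ) • φm - (Complex.I * (Real.sin (θ + φ + ω) : ℂ)) • φp := by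
  rw [← neg_neg (Real.cos (θ + φ + ω) : ℂ), ← Complex.ofReal_neg,
    show B θ φ ω 0 = swapSettings (B₁ θ φ ω) from rfl, op_swapSettings, B₁_eq_correlationSum]
  exact op_correlationSum_φm K_zero_swap K_one_swap (sum_weight_mul_sin_swapped hβ)
    (sum_weight_mul_cos_swapped hβ)

end Eigenvectors

theorem orthonormal : Orthonormal ℂ ![φp, -φm] := by
  have hr : ((1 / √2 : ℝ) : ℂ) * ((1 / √2 : ℝ) : ℂ) = 1 / 2 := by
    rw [← Complex.ofReal_mul, div_mul_div_comm, Real.mul_self_sqrt zero_le_two]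
    norm_num
  refine orthonormal_pair ?_ ?_ ?_ <;>
  simp only [φp, φm, inner_add_left, inner_add_right, inner_sub_left, inner_sub_right,
    inner_neg_left, inner_neg_right, inner_smul_left, inner_smul_right, inner_ket_ket,
    Complex.conj_ofReal, Complex.conj_I, ↓reduceIte, Matrix.vecCons_inj, zero_ne_one, one_ne_zero,
    and_true, and_self] <;>
  generalize ((1 / √2 : ℝ) : ℂ) = r at *
  · linear_combination 2 * hr - r * r * Complex.I_mul_I
  · linear_combination 2 * hr - r * r * Complex.I_mul_I
  · linear_combination -(r * r) * Complex.I_mul_I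

theorem isReflection_output (δ : ℝ) :
    IsReflection (-(Real.cos δ : ℂ) • σZ - (Real.sin δ : ℂ) • σY) := by
  have h := (isReflection_σZ.smul_add_smul isReflection_σY σZ_mul_σY_add
    (Real.cos_sq_add_sin_sq δ)).neg
  rwa [neg_add', ← neg_smul] at h

theorem givesComplex {θ φ ω : ℝ}
    (h : Real.cos (θ + φ) * Real.cos φ * Real.cos (θ + ω) * Real.cos ω < 0) :
    GivesComplex.{u} (B θ φ ω) (K θ φ ω) φp (-φm)
      ![-(Real.cos (θ + φ + ω) : ℂ) • σZ - (Real.sin (θ + φ + ω) : ℂ) • σY, σZ] := by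
  have hβ := β_ne_zero h
  refine givesComplex_of_intertwining (boundedBy_B h) (isReflection_K θ φ ω)
    (Fin.forall_fin_two.2 ⟨isReflection_output _, isReflection_σZ⟩) orthonormal ?_
  simp only [Fin.forall_fin_two, Matrix.cons_val_zero, Matrix.cons_val_one, map_neg,
    op_B_one_φp hβ, op_B_one_φm hβ, op_B_zero_φp hβ, op_B_zero_φm hβ, sub_apply, smul_apply,
    σZ_ket, σY_ket, map_sub, map_smul, adjoint_coisometryOf_ket, Fin.val_zero, Fin.val_one,
    pow_zero, pow_one, zero_add, show (1 + 1 : Fin 2) = 0 from rfl]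
  refine ⟨⟨?_, ?_⟩, ?_, ?_⟩ <;> module

end WBC

/-! ### BASTA: bounds -/

namespace BASTA

/-- `K_x^{(i)} ⨂_{v ≠ i} K^{(v)}_{s v}`: the value of `s` at `i` is ignored. -/
noncomputable def attach {V : Type} [Fintype V] [DecidableEq V] (i : V)
    (s : V → Option (Fin 2)) (x : Fin 2) : BellFunctional V :=
  mono fun v => if v = i then some x else s v

variable {V : Type} [Fintype V] [DecidableEq V]

theorem op_attach_eq_mul {ι : V → Type*} (K : ∀ v, Fin 2 → Op (ι v)) (i : V)
    (s : V → Option (Fin 2)) (x : Fin 2) :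
    (attach i s x).op K =
      (attach i (fun _ => none) x).op K * (mono (Function.update s i none)).op K := by
  rw [attach, attach, BellFunctional.op_mono_mul]
  · congr 2
    funext v
    rcases eq_or_ne v i with rfl | hv <;> simp [*]
  · intro v
    rcases eq_or_ne v i with rfl | hv <;> simp [*]

theorem commutingObservables_attach {ι : V → Type*} {K : ∀ v, Fin 2 → Op (ι v)}
    (hK : ∀ v x, AbsLE 1 (K v x)) (i : V) (x : Fin 2 → Fin 2)
    (s : Fin 2 → V → Option (Fin 2)) :
    CommutingObservables (fun z => (attach i (fun _ => none) (x z)).op K)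
      (fun w => (mono (Function.update (s w) i none)).op K) where
  left z := BellFunctional.absLE_op_mono hK _
  right w := BellFunctional.absLE_op_mono hK _
  commute z w := BellFunctional.commute_op_mono K fun v => by
    rcases eq_or_ne v i with rfl | hv <;> simp [*]

theorem absLE_attach_chsh {ι : V → Type*} {K : ∀ v, Fin 2 → Op (ι v)}
    (hK : ∀ v x, AbsLE 1 (K v x)) (i : V) (s t : V → Option (Fin 2)) (x y : Fin 2) :
    AbsLE (2 * √2)
      ((attach i s x + attach i s y + attach i t x - attach i t y).op K) := by
  simp only [BellFunctional.op_add, BellFunctional.op_sub, op_attach_eq_mul K i s,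
    op_attach_eq_mul K i t]
  simpa only [Matrix.cons_val_zero, Matrix.cons_val_one] using
    absLE_chsh (commutingObservables_attach hK i ![x, y] ![s, t])

variable (G : SimpleGraph V) [DecidableRel G.Adj] (i : V)

theorem B_eq_sum_chsh : B G i =
    ∑ j ∈ G.neighborFinset i, (centralTerm G i 0 + centralTerm G i 1 + neighbourTerm G i j 0 -
      neighbourTerm G i j 1) + ∑ j with j ≠ i ∧ ¬ G.Adj i j, farTerm G j := by
  simp only [B, add_sub_assoc, Finset.sum_add_distrib, Finset.sum_const,
    G.card_neighborFinset_eq_degree, smul_add, ← Nat.cast_smul_eq_nsmul ℝ]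

theorem B'_eq_neg_sum_chsh : B' G i =
    -∑ j ∈ G.neighborFinset i, (evenTerm G i j 1 + evenTerm G i j 0 + fullTerm i 1 -
      fullTerm i 0) := by
  simp only [B', add_sub_assoc, Finset.sum_add_distrib, Finset.sum_const,
    G.card_neighborFinset_eq_degree, ← Nat.cast_smul_eq_nsmul ℝ]
  module

theorem card_far : (Finset.card {j | j ≠ i ∧ ¬ G.Adj i j} : ℝ) =
    Fintype.card V - 1 - G.degree i := by
  have hcompl : ({j | j ≠ i ∧ ¬ G.Adj i j} : Finset V) = (insert i (G.neighborFinset i))ᶜ := by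
    ext j
    simp
  rw [hcompl, Finset.card_compl, Nat.cast_sub (Finset.card_le_univ _),
    Finset.card_insert_of_notMem (by simp), G.card_neighborFinset_eq_degree]
  push_cast
  ring

theorem boundedBy_B : BellFunctional.BoundedBy.{u} (β₁ G i) (B G i) := by
  have hβ : β₁ G i = ∑ _j ∈ G.neighborFinset i, 2 * √2 +
      ∑ j : V with j ≠ i ∧ ¬ G.Adj i j, 1 := by
    rw [Finset.sum_const, Finset.sum_const, nsmul_eq_mul, nsmul_eq_mul, card_far,
      G.card_neighborFinset_eq_degree, β₁]
    ring
  refine .of_absLE fun ι K hK => ?_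
  rw [hβ, B_eq_sum_chsh, BellFunctional.op_add, BellFunctional.op_sum, BellFunctional.op_sum]
  exact (AbsLE.sum fun j _ => absLE_attach_chsh hK i _ _ 0 1).add
    (AbsLE.sum fun j _ => BellFunctional.absLE_op_mono hK _)

theorem boundedBy_B' : BellFunctional.BoundedBy.{u} (2 * √2 * G.degree i) (B' G i) := by
  have hβ : 2 * √2 * G.degree i = ∑ _j ∈ G.neighborFinset i, 2 * √2 := by
    rw [Finset.sum_const, nsmul_eq_mul, G.card_neighborFinset_eq_degree, mul_comm]
  refine .of_absLE fun ι K hK => ?_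
  rw [hβ, B'_eq_neg_sum_chsh, BellFunctional.op_neg, BellFunctional.op_sum]
  exact (AbsLE.sum fun j _ => absLE_attach_chsh hK i _ _ 1 0).neg

end BASTA

/-! ### BASTA: graph states -/

theorem prod_edgeFinset_eq_prod_neighborFinset {V M : Type*} [CommMonoid M] {G : SimpleGraph V}
    [Fintype G.edgeSet] {j : V} [Fintype (G.neighborSet j)] {f : Sym2 V → M}
    (hf : ∀ e, j ∉ e → f e = 1) :
    ∏ e ∈ G.edgeFinset, f e = ∏ k ∈ G.neighborFinset j, f s(j, k) := by
  classical
  have hinj : Set.InjOn (fun k => s(j, k)) (G.neighborFinset j : Set V) :=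
    fun a _ b _ hab => Sym2.congr_right.1 hab
  rw [← Finset.prod_image hinj]
  refine (Finset.prod_subset ?_ fun e he hne => hf e fun hj => hne ?_).symm
  · intro e he
    obtain ⟨k, hk, rfl⟩ := Finset.mem_image.1 he
    simpa using hk
  · obtain ⟨k, rfl⟩ := hj
    exact Finset.mem_image.2 ⟨k, by simpa using he, rfl⟩

namespace BASTA

variable {V : Type} [Fintype V] [DecidableEq V] (G : SimpleGraph V) [DecidableRel G.Adj]

/-- The factor of the edge `e` in the phase `(-1) ^ edgeCount G x`. -/
noncomputable def edgeSign (x : V → Fin 2) (e : Sym2 V) : ℂ :=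
  if ∀ v ∈ e, x v = 1 then -1 else 1

/-- The bit string `x` with its bit at `j` flipped. -/
def flipBit (j : V) (x : V → Fin 2) : V → Fin 2 := Function.update x j (x j + 1)

omit [Fintype V] in
theorem flipBit_involutive (j : V) : Function.Involutive (flipBit j) := fun x => by
  have h : ∀ a : Fin 2, a + 1 + 1 = a := by decide
  simp [flipBit, h]

theorem prod_edgeSign (x : V → Fin 2) :
    ∏ e ∈ G.edgeFinset, edgeSign x e = (-1) ^ edgeCount G x := by
  simp [edgeSign, edgeCount, Finset.prod_ite]

theorem edgeSign_mul_edgeSign_flipBit (x : V → Fin 2) {j k : V} (hk : k ≠ j) :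
    edgeSign x s(j, k) * edgeSign (flipBit j x) s(j, k) = (-1) ^ (x k : ℕ) := by
  simp only [edgeSign, flipBit, Sym2.mem_iff, forall_eq_or_imp, forall_eq, Function.update_self,
    Function.update_of_ne hk]
  generalize x j = a, x k = b
  fin_cases a <;> fin_cases b <;> simp

theorem edgeSign_mul_edgeSign_flipBit_of_notMem (x : V → Fin 2) {j : V} {e : Sym2 V}
    (hj : j ∉ e) : edgeSign x e * edgeSign (flipBit j x) e = 1 := by
  have hflip : ∀ v ∈ e, flipBit j x v = x v := fun v hv =>
    Function.update_of_ne (ne_of_mem_of_not_mem hv hj) _ _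
  have hiff : (∀ v ∈ e, flipBit j x v = 1) ↔ ∀ v ∈ e, x v = 1 :=
    forall₂_congr fun v hv => by rw [hflip v hv]
  simp only [edgeSign, hiff]
  split_ifs <;> norm_num

theorem neg_one_pow_edgeCount_flipBit (x : V → Fin 2) (j : V) :
    (-1 : ℂ) ^ edgeCount G x * ∏ k ∈ G.neighborFinset j, (-1 : ℂ) ^ (x k : ℕ) =
      (-1 : ℂ) ^ edgeCount G (flipBit j x) := by
  have hprod : (-1 : ℂ) ^ edgeCount G x * (-1 : ℂ) ^ edgeCount G (flipBit j x) =
      ∏ k ∈ G.neighborFinset j, (-1 : ℂ) ^ (x k : ℕ) := by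
    rw [← prod_edgeSign, ← prod_edgeSign, ← Finset.prod_mul_distrib,
      prod_edgeFinset_eq_prod_neighborFinset fun e => edgeSign_mul_edgeSign_flipBit_of_notMem x]
    exact Finset.prod_congr rfl fun k hk =>
      edgeSign_mul_edgeSign_flipBit x (G.ne_of_adj ((G.mem_neighborFinset j k).1 hk)).symm
  rw [← hprod, ← mul_assoc, ← mul_pow, neg_one_mul, neg_neg, one_pow, one_mul]

theorem stabilizer_ket (x : V → Fin 2) (j : V) :
    stabilizer G j (ket x) =
      (∏ k ∈ G.neighborFinset j, (-1 : ℂ) ^ (x k : ℕ)) • ket (flipBit j x) := by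
  have h : ∀ v, (if v = j then σX else if G.Adj j v then σZ else 1 : Op (Fin 2)) (ket (x v)) =
      (if G.Adj j v then (-1 : ℂ) ^ (x v : ℕ) else 1) • ket (flipBit j x v) := fun v => by
    rcases eq_or_ne v j with rfl | hv
    · simp [flipBit, σX_ket]
    · by_cases ha : G.Adj j v <;> simp [flipBit, hv, ha, σZ_ket]
  rw [stabilizer, tensorOp_ket_of_monomial h, Finset.prod_ite, Finset.prod_const_one, mul_one,
    SimpleGraph.neighborFinset_eq_filter]

theorem stabilizer_φp (j : V) : stabilizer G j (φp G) = φp G := by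
  rw [φp, map_smul, map_sum]
  simp only [map_smul, stabilizer_ket, smul_smul, neg_one_pow_edgeCount_flipBit]
  congr 1
  exact Equiv.sum_comp (flipBit_involutive j).toPerm
    fun x : V → Fin 2 => (-1 : ℂ) ^ edgeCount G x • ket x

/-- `⨂_v Z_v`, which exchanges the graph and the antigraph states. -/
noncomputable def parity (V : Type) [Fintype V] : Op (V → Fin 2) := tensorOp fun _ => σZ

omit [DecidableEq V] in
theorem isReflection_parity : IsReflection (parity V) where
  isSelfAdjoint := by
    rw [IsSelfAdjoint, parity, star_tensorOp, isReflection_σZ.isSelfAdjoint.star_eq]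
  mul_self := by
    rw [parity, tensorOp_mul, isReflection_σZ.mul_self, tensorOp_one]

theorem parity_φp : parity V (φp G) = φm G := by
  simp only [φp, φm, parity, map_smul, map_sum,
    tensorOp_ket_of_monomial fun _ => σZ_ket _, smul_smul, Finset.prod_pow_eq_pow_sum, ← pow_add]

theorem parity_φm : parity V (φm G) = φp G := by
  rw [← parity_φp, ← mul_apply_eq_comp, isReflection_parity.mul_self, one_apply_eq_self]

theorem isSelfAdjoint_stabilizer (j : V) : IsSelfAdjoint (stabilizer G j) := by
  rw [IsSelfAdjoint, stabilizer, star_tensorOp]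
  congr 1
  funext v
  split_ifs
  exacts [isReflection_σX.isSelfAdjoint, isReflection_σZ.isSelfAdjoint, star_one _]

theorem stabilizer_mul_parity (j : V) :
    stabilizer G j * parity V = -(parity V * stabilizer G j) := by
  rw [stabilizer, parity, tensorOp_mul, tensorOp_mul]
  refine tensorOp_eq_neg j ?_ fun v hv => ?_
  · rw [if_pos rfl, eq_neg_iff_add_eq_zero, add_comm, σZ_mul_σX_add]
  · rw [if_neg hv]
    split_ifs <;> simp

theorem stabilizer_φm (j : V) : stabilizer G j (φm G) = -φm G := by
  rw [← parity_φp, ← mul_apply_eq_comp, stabilizer_mul_parity, neg_apply, mul_apply_eq_comp,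
    stabilizer_φp]

theorem inner_φp_φp : inner ℂ (φp G) (φp G) = (1 : ℂ) := by
  have hN : (2 : ℂ) ^ Fintype.card V ≠ 0 := pow_ne_zero _ two_ne_zero
  have hr : ((1 / √(2 ^ Fintype.card V) : ℝ) : ℂ) * ((1 / √(2 ^ Fintype.card V) : ℝ) : ℂ) =
      1 / 2 ^ Fintype.card V := by
    rw [← Complex.ofReal_mul, div_mul_div_comm, Real.mul_self_sqrt (by positivity)]
    push_cast
    rw [one_mul]
  have hsq : ∀ (r : ℂ) (n : ℕ), (-1 : ℂ) ^ n * (r * (-1) ^ n) = r := fun r n => by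
    rw [mul_left_comm, ← mul_pow, neg_one_mul, neg_neg, one_pow, mul_one]
  simp only [φp, inner_smul_left, inner_smul_right, sum_inner, inner_sum, inner_ket_ket,
    Complex.conj_ofReal, map_pow, map_neg, map_one, mul_ite, mul_one, mul_zero,
    Finset.sum_ite_eq', Finset.mem_univ, if_true, hsq, Finset.sum_const, Finset.card_univ,
    Fintype.card_fun, Fintype.card_fin, nsmul_eq_mul]
  rw [mul_left_comm, hr]
  push_cast
  exact mul_one_div_cancel hN

theorem orthonormal (i : V) : Orthonormal ℂ ![φp G, φm G] := by
  refine orthonormal_pair (inner_φp_φp G) ?_ (self_eq_neg.1 ?_)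
  · nth_rewrite 1 [← parity_φp]
    rw [← ContinuousLinearMap.adjoint_inner_right, ← ContinuousLinearMap.star_eq_adjoint,
      isReflection_parity.isSelfAdjoint.star_eq, parity_φm, inner_φp_φp]
  · nth_rewrite 1 [← stabilizer_φp G i]
    rw [← ContinuousLinearMap.adjoint_inner_right, ← ContinuousLinearMap.star_eq_adjoint,
      (isSelfAdjoint_stabilizer G i).star_eq, stabilizer_φm, inner_neg_right]

end BASTA

namespace BASTA

section Observables

variable {V : Type} [DecidableEq V] (i : V)

theorem K_of_ne {v : V} (hv : v ≠ i) : K i v = ![σX, σZ] := if_neg hv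

theorem K_self : K i i =
    ![((1 / √2 : ℝ) : ℂ) • (σX + σZ), ((1 / √2 : ℝ) : ℂ) • (σX - σZ)] := if_pos rfl

theorem one_div_sqrt_two_add_self :
    ((1 / √2 : ℝ) : ℂ) + ((1 / √2 : ℝ) : ℂ) = ((√2 : ℝ) : ℂ) := by
  rw [← Complex.ofReal_add, ← two_mul, mul_one_div, Real.div_sqrt]

theorem K_self_add : K i i 0 + K i i 1 = ((√2 : ℝ) : ℂ) • σX := by
  rw [K_self, ← one_div_sqrt_two_add_self, Matrix.cons_val_zero, Matrix.cons_val_one]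
  simp only [Matrix.cons_val_zero]
  module

theorem K_self_sub : K i i 0 - K i i 1 = ((√2 : ℝ) : ℂ) • σZ := by
  rw [K_self, ← one_div_sqrt_two_add_self, Matrix.cons_val_zero, Matrix.cons_val_one]
  simp only [Matrix.cons_val_zero]
  module

theorem isReflection_K (v : V) (x : Fin 2) : IsReflection (K i v x) := by
  rcases eq_or_ne v i with rfl | hv
  · have hsq : (1 / √2) ^ 2 = 1 / 2 := by
      rw [div_pow, Real.sq_sqrt zero_le_two, one_pow]
    have hXZ : σX * σZ + σZ * σX = 0 := (add_comm _ _).trans σZ_mul_σX_add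
    rw [K_self]
    fin_cases x
    · have h := isReflection_σX.smul_add_smul isReflection_σZ hXZ
        (r := 1 / √2) (s := 1 / √2) (by rw [hsq, add_halves])
      rwa [← smul_add] at h
    · have h := isReflection_σX.smul_add_smul isReflection_σZ hXZ
        (r := 1 / √2) (s := -(1 / √2)) (by rw [neg_sq, hsq, add_halves])
      rwa [Complex.ofReal_neg, neg_smul, ← sub_eq_add_neg, ← smul_sub] at h
  · rw [K_of_ne i hv]
    fin_cases x
    exacts [isReflection_σX, isReflection_σZ]

end Observables

section BellOperator

variable {V : Type} [Fintype V] [DecidableEq V] (i : V)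

theorem op_attach (s : V → Option (Fin 2)) (x : Fin 2) :
    (attach i s x).op (K i) =
      tensorMap _ (Function.update (fun v => (s v).elim 1 (K i v)) i (K i i x)) := by
  rw [attach, BellFunctional.op_mono, tensorMap_apply]
  congr 1
  funext v
  rcases eq_or_ne v i with rfl | hv <;> simp [*]

theorem tensorMap_update_smul_eq {s : V → Option (Fin 2)} {A : V → Op (Fin 2)}
    (hA : ∀ v ≠ i, A v = (s v).elim 1 ![σX, σZ]) (c : ℂ) :
    tensorMap _ (Function.update (fun v => (s v).elim 1 (K i v)) i (c • A i)) =
      c • tensorOp A := by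
  rw [MultilinearMap.map_update_smul, tensorMap_apply]
  congr 2
  rw [eq_comm, Function.eq_update_iff]
  exact ⟨rfl, fun v hv => by rw [hA v hv, K_of_ne i hv]⟩

theorem op_attach_add {s : V → Option (Fin 2)} {A : V → Op (Fin 2)} (hi : A i = σX)
    (hA : ∀ v ≠ i, A v = (s v).elim 1 ![σX, σZ]) :
    (attach i s 0 + attach i s 1).op (K i) = ((√2 : ℝ) : ℂ) • tensorOp A := by
  rw [BellFunctional.op_add, op_attach, op_attach, ← MultilinearMap.map_update_add, K_self_add,
    ← hi, tensorMap_update_smul_eq i hA]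

theorem op_attach_sub {s : V → Option (Fin 2)} {A : V → Op (Fin 2)} (hi : A i = σZ)
    (hA : ∀ v ≠ i, A v = (s v).elim 1 ![σX, σZ]) :
    (attach i s 0 - attach i s 1).op (K i) = ((√2 : ℝ) : ℂ) • tensorOp A := by
  rw [BellFunctional.op_sub, op_attach, op_attach, ← MultilinearMap.map_update_sub, K_self_sub,
    ← hi, tensorMap_update_smul_eq i hA]

variable (G : SimpleGraph V) [DecidableRel G.Adj]

theorem op_centralTerm_add : (centralTerm G i 0 + centralTerm G i 1).op (K i) =
    ((√2 : ℝ) : ℂ) • stabilizer G i :=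
  op_attach_add i (if_pos rfl) fun v hv => by
    rw [if_neg hv]
    split_ifs <;> rfl

theorem op_neighbourTerm_sub {j : V} (hj : G.Adj i j) :
    (neighbourTerm G i j 0 - neighbourTerm G i j 1).op (K i) = ((√2 : ℝ) : ℂ) • stabilizer G j :=
  op_attach_sub i (by rw [if_neg (G.ne_of_adj hj), if_pos hj.symm]) fun v _ => by
    split_ifs <;> rfl

theorem op_farTerm {j : V} (hj : j ≠ i) (hij : ¬ G.Adj i j) :
    (farTerm G j).op (K i) = stabilizer G j := by
  rw [farTerm, BellFunctional.op_mono, stabilizer]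
  congr 1
  funext v
  rcases eq_or_ne v j with rfl | hv
  · simp [K_of_ne i hj]
  · by_cases ha : G.Adj j v
    · have hvi : v ≠ i := fun h => hij (h ▸ ha.symm)
      simp [hv, ha, K_of_ne i hvi]
    · simp [hv, ha]

theorem op_fullTerm_sub :
    (fullTerm i 0 - fullTerm i 1).op (K i) = ((√2 : ℝ) : ℂ) • parity V :=
  op_attach_sub i rfl fun _ _ => rfl

theorem op_evenTerm_add {j : V} (hj : G.Adj i j) :
    (evenTerm G i j 0 + evenTerm G i j 1).op (K i) =
      -(((√2 : ℝ) : ℂ) • (parity V * stabilizer G i * stabilizer G j)) := by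
  have hprod : (tensorOp fun v => if v = i then σX else if v = j then σX else
      if (G.Adj i v ↔ G.Adj j v) then σZ else 1) =
      -(parity V * stabilizer G i * stabilizer G j) := by
    rw [parity, stabilizer, stabilizer, tensorOp_mul, tensorOp_mul]
    refine tensorOp_eq_neg i ?_ fun v hv => ?_
    · rw [if_pos rfl, if_pos rfl, if_neg (G.ne_of_adj hj), if_pos hj.symm,
        eq_neg_of_add_eq_zero_left σZ_mul_σX_add, neg_mul, neg_neg, mul_assoc,
        isReflection_σZ.mul_self, mul_one]
    · rw [if_neg hv, if_neg hv]
      rcases eq_or_ne v j with rfl | hvj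
      · simp [hj, isReflection_σZ.mul_self]
      · by_cases h₁ : G.Adj i v <;> by_cases h₂ : G.Adj j v <;>
          simp [hvj, h₁, h₂, isReflection_σZ.mul_self]
  rw [← smul_neg, ← hprod]
  refine op_attach_add i (if_pos rfl) fun v hv => ?_
  rw [if_neg hv]
  split_ifs <;> rfl

theorem op_B : (B G i).op (K i) =
    (G.degree i : ℂ) • (((√2 : ℝ) : ℂ) • stabilizer G i) +
      ∑ j ∈ G.neighborFinset i, ((√2 : ℝ) : ℂ) • stabilizer G j +
      ∑ j with j ≠ i ∧ ¬ G.Adj i j, stabilizer G j := by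
  rw [B, BellFunctional.op_add, BellFunctional.op_add, BellFunctional.op_smul, op_centralTerm_add,
    BellFunctional.op_sum, BellFunctional.op_sum, Complex.ofReal_natCast]
  congr 1
  · congr 1
    exact Finset.sum_congr rfl fun j hj =>
      op_neighbourTerm_sub i G ((G.mem_neighborFinset i j).1 hj)
  · refine Finset.sum_congr rfl fun j hj => ?_
    obtain ⟨-, hji, hij⟩ := Finset.mem_filter.1 hj
    exact op_farTerm i G hji hij

theorem op_B' : (B' G i).op (K i) =
    (G.degree i : ℂ) • (((√2 : ℝ) : ℂ) • parity V) -
      ∑ j ∈ G.neighborFinset i,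
        -(((√2 : ℝ) : ℂ) • (parity V * stabilizer G i * stabilizer G j)) := by
  rw [B', BellFunctional.op_sub, BellFunctional.op_smul, op_fullTerm_sub, BellFunctional.op_sum,
    Complex.ofReal_natCast]
  congr 1
  exact Finset.sum_congr rfl fun j hj => op_evenTerm_add i G ((G.mem_neighborFinset i j).1 hj)

end BellOperator

section Eigenvectors

variable {V : Type} [Fintype V] [DecidableEq V] (G : SimpleGraph V) [DecidableRel G.Adj] (i : V)

theorem op_B_apply {ψ : Hil (V → Fin 2)} {ε : ℂ} (h : ∀ j, stabilizer G j ψ = ε • ψ) :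
    (B G i).op (K i) ψ = (ε * β₁ G i) • ψ := by
  have hfar : (Finset.card {j | j ≠ i ∧ ¬ G.Adj i j} : ℂ) = Fintype.card V - 1 - G.degree i := by
    exact_mod_cast card_far G i
  simp only [op_B, add_apply, smul_apply, sum_apply, h, Finset.sum_const,
    ← Nat.cast_smul_eq_nsmul ℂ, hfar, G.card_neighborFinset_eq_degree, β₁]
  push_cast
  module

theorem op_B'_apply {ψ : Hil (V → Fin 2)} {ε : ℂ} (hε : ε * ε = 1)
    (h : ∀ j, stabilizer G j ψ = ε • ψ) :
    (B' G i).op (K i) ψ = ((2 * √2 * G.degree i : ℝ) : ℂ) • parity V ψ := by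
  simp only [op_B', sub_apply, smul_apply, sum_apply, neg_apply, mul_apply_eq_comp, h, map_smul,
    smul_smul _ _ (parity V ψ), hε, one_smul, Finset.sum_const, ← Nat.cast_smul_eq_nsmul ℂ,
    G.card_neighborFinset_eq_degree]
  push_cast
  module

theorem op_B_φp : (B G i).op (K i) (φp G) = (β₁ G i : ℂ) • φp G := by
  rw [op_B_apply G i (ε := 1) fun j => by rw [stabilizer_φp, one_smul], one_mul]

theorem op_B_φm : (B G i).op (K i) (φm G) = -(β₁ G i : ℂ) • φm G := by
  rw [op_B_apply G i (ε := -1) fun j => by rw [stabilizer_φm, neg_one_smul], neg_one_mul]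

theorem op_B'_φp : (B' G i).op (K i) (φp G) = ((2 * √2 * G.degree i : ℝ) : ℂ) • φm G := by
  rw [op_B'_apply G i (one_mul 1) fun j => by rw [stabilizer_φp, one_smul], parity_φp]

theorem op_B'_φm : (B' G i).op (K i) (φm G) = ((2 * √2 * G.degree i : ℝ) : ℂ) • φp G := by
  rw [op_B'_apply G i (ε := -1) (by norm_num) fun j => by rw [stabilizer_φm, neg_one_smul],
    parity_φm]

end Eigenvectors

section Normalized

variable {V : Type} [Fintype V] {G : SimpleGraph V} [DecidableRel G.Adj] {i : V}
  (hi : 0 < G.degree i)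

include hi

theorem β₀_pos : 0 < β₀ G i := by
  have hd : (0 : ℝ) < G.degree i := by exact_mod_cast hi
  exact mul_pos (by positivity) hd

theorem β₁_pos : 0 < β₁ G i := by
  have hd : (0 : ℝ) < G.degree i := by exact_mod_cast hi
  have hV : (1 : ℝ) ≤ Fintype.card V := by exact_mod_cast Fintype.card_pos_iff.2 ⟨i⟩
  have hcoeff : 0 < 2 * √2 - 1 := by linarith [Real.one_lt_sqrt_two]
  rw [β₁]
  linarith [mul_pos hcoeff hd]

variable [DecidableEq V]

theorem actsAsXZ : ActsAsXZ (fun y => (normalizedB G i y).op (K i)) (φp G) (φm G) := by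
  have hβ₀ : (((1 / β₀ G i : ℝ)) : ℂ) * ((2 * √2 * G.degree i : ℝ) : ℂ) = 1 := by
    rw [← Complex.ofReal_mul, ← Complex.ofReal_one]
    exact congrArg _ (one_div_mul_cancel (β₀_pos hi).ne')
  have hβ₁ : ((1 / β₁ G i : ℝ) : ℂ) * ((β₁ G i : ℝ) : ℂ) = 1 := by
    rw [← Complex.ofReal_mul, one_div_mul_cancel (β₁_pos hi).ne', Complex.ofReal_one]
  constructor <;>
  simp only [normalizedB, Matrix.cons_val_zero, Matrix.cons_val_one, BellFunctional.op_smul,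
    smul_apply, op_B_φp, op_B_φm, op_B'_φp, op_B'_φm, smul_neg, smul_smul, hβ₀, hβ₁, neg_smul,
    one_smul]

theorem givesComplex : GivesComplex.{u} (normalizedB G i) (K i) (φp G) (φm G) ![σX, σZ] :=
  (actsAsXZ hi).givesComplex
    (Fin.forall_fin_two.2 ⟨(boundedBy_B' G i).one_div_smul (β₀_pos hi),
      (boundedBy_B G i).one_div_smul (β₁_pos hi)⟩)
    (isReflection_K i) (orthonormal G i)

end Normalized

end BASTA

theorem mainTheorem8 :
    -- CHSH / Tsirelson
    ((CHSH.B 1).op CHSH.K CHSH.φp = CHSH.φp ∧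
      (CHSH.B 1).op CHSH.K CHSH.φm = -CHSH.φm ∧
      (CHSH.B 0).op CHSH.K CHSH.φp = CHSH.φm ∧
      (CHSH.B 0).op CHSH.K CHSH.φm = CHSH.φp ∧
      GivesComplex.{u} CHSH.B CHSH.K CHSH.φp CHSH.φm ![σX, σZ]) ∧
    -- tilted CHSH
    (∀ θ : ℝ,
      (Tilted.B θ 1).op (Tilted.K θ) (Tilted.φp θ) = Tilted.φp θ ∧
      (Tilted.B θ 1).op (Tilted.K θ) (Tilted.φm θ) = -Tilted.φm θ ∧
      (Tilted.B θ 0).op (Tilted.K θ) (Tilted.φp θ) = Tilted.φm θ ∧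
      (Tilted.B θ 0).op (Tilted.K θ) (Tilted.φm θ) = Tilted.φp θ ∧
      GivesComplex.{u} (Tilted.B θ) (Tilted.K θ) (Tilted.φp θ) (Tilted.φm θ) ![σX, σZ]) ∧
    -- WBC
    (∀ θ φ ω : ℝ,
      Real.cos (θ + φ) * Real.cos φ * Real.cos (θ + ω) * Real.cos ω < 0 →
      (WBC.B θ φ ω 1).op (WBC.K θ φ ω) WBC.φp = WBC.φp ∧
      (WBC.B θ φ ω 1).op (WBC.K θ φ ω) WBC.φm = -WBC.φm ∧
      (WBC.B θ φ ω 0).op (WBC.K θ φ ω) WBC.φp =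
        -(Real.cos (θ + φ + ω) : ℂ) • WBC.φp
          + (Complex.I * (Real.sin (θ + φ + ω) : ℂ)) • WBC.φm ∧
      (WBC.B θ φ ω 0).op (WBC.K θ φ ω) WBC.φm =
        (Real.cos (θ + φ + ω) : ℂ) • WBC.φm
          - (Complex.I * (Real.sin (θ + φ + ω) : ℂ)) • WBC.φp ∧
      GivesComplex.{u} (WBC.B θ φ ω) (WBC.K θ φ ω) WBC.φp (-WBC.φm)
        ![-(Real.cos (θ + φ + ω) : ℂ) • σZ - (Real.sin (θ + φ + ω) : ℂ) • σY, σZ]) ∧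
    -- BASTA
    (∀ (V : Type) [Fintype V] [DecidableEq V] (G : SimpleGraph V) [DecidableRel G.Adj] (i : V),
      (∀ j, BASTA.stabilizer G j (BASTA.φp G) = BASTA.φp G ∧
        BASTA.stabilizer G j (BASTA.φm G) = -BASTA.φm G) ∧
      BellFunctional.BoundedBy.{u} (BASTA.β₁ G i) (BASTA.B G i) ∧
      (BASTA.B G i).op (BASTA.K i) (BASTA.φp G) = (BASTA.β₁ G i : ℂ) • BASTA.φp G ∧
      (BASTA.B G i).op (BASTA.K i) (BASTA.φm G) = -(BASTA.β₁ G i : ℂ) • BASTA.φm G ∧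
      BellFunctional.BoundedBy.{u} (2 * √2 * G.degree i) (BASTA.B' G i) ∧
      (BASTA.B' G i).op (BASTA.K i) (BASTA.φp G) =
        ((2 * √2 * G.degree i : ℝ) : ℂ) • BASTA.φm G ∧
      (BASTA.B' G i).op (BASTA.K i) (BASTA.φm G) =
        ((2 * √2 * G.degree i : ℝ) : ℂ) • BASTA.φp G ∧
      (0 < G.degree i →
        (BASTA.normalizedB G i 1).op (BASTA.K i) (BASTA.φp G) = BASTA.φp G ∧
        (BASTA.normalizedB G i 1).op (BASTA.K i) (BASTA.φm G) = -BASTA.φm G ∧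
        (BASTA.normalizedB G i 0).op (BASTA.K i) (BASTA.φp G) = BASTA.φm G ∧
        (BASTA.normalizedB G i 0).op (BASTA.K i) (BASTA.φm G) = BASTA.φp G ∧
        GivesComplex.{u} (BASTA.normalizedB G i) (BASTA.K i) (BASTA.φp G) (BASTA.φm G)
          ![σX, σZ])) := by
  refine ⟨?chsh, fun θ => ?tilted, fun θ φ ω h => ?wbc, fun V _ _ G _ i => ?basta⟩
  case chsh =>
    have h := CHSH.actsAsXZ
    exact ⟨h.one_fst, h.one_snd, h.zero_fst, h.zero_snd, CHSH.givesComplex⟩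
  case tilted =>
    have h := Tilted.actsAsXZ θ
    exact ⟨h.one_fst, h.one_snd, h.zero_fst, h.zero_snd, Tilted.givesComplex θ⟩
  case wbc =>
    have hβ := WBC.β_ne_zero h
    exact ⟨WBC.op_B_one_φp hβ, WBC.op_B_one_φm hβ, WBC.op_B_zero_φp hβ, WBC.op_B_zero_φm hβ,
      WBC.givesComplex h⟩
  case basta =>
    refine ⟨fun j => ⟨BASTA.stabilizer_φp G j, BASTA.stabilizer_φm G j⟩,
      BASTA.boundedBy_B G i, BASTA.op_B_φp G i, BASTA.op_B_φm G i,
      BASTA.boundedBy_B' G i, BASTA.op_B'_φp G i, BASTA.op_B'_φm G i, fun hi => ?_⟩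
    have h := BASTA.actsAsXZ hi
    exact ⟨h.one_fst, h.one_snd, h.zero_fst, h.zero_snd, BASTA.givesComplex hi⟩
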